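/- **Conventions.** Let $\Omega$ be a finite set of cardinality $d\ge 3$, let $T$ be a $d$-regular tree with vertex set $V$, and fix a colouring of the edges of $T$ by $\Omega$ which, around every vertex, is a bijection from the edges at that vertex onto $\Omega$. For $g\in\mathrm{Aut}(T)$ and $v\in V$, let $\sigma(g,v)\in\mathrm{Sym}(\Omega)$ be the local permutation of $g$ at $v$, sending the colour of an edge $e$ at $v$ to the colour of $ge$. For $F\le F'\le \mathrm{Sym}(\Omega)$ let $G(F,F')$ be the group of $g\in\mathrm{Aut}(T)$ with $\sigma(g,v)\in F'$ for all $v$ and $\sigma(g,v)\in F$ for all but finitely many $v$. Fix $v_0\in V$, and let $K(F,F')$ and $K_d$ be the stabilizers of $v_0$ in $G(F,F')$ and in $\mathrm{Aut}(T)$. For $n\ge 1$ let $\mathfrak S_n$ be the symmetric group on $\{0,\dots,n-1\}$, let $\mathfrak S_{n-1}\le\mathfrak S_n$ be the stabilizer of $0$, let $U_{n,d}=\mathfrak S_n^{V,\mathfrak S_{n-1}}$ be the group of functions $V\to\mathfrak S_n$ with values in $\mathfrak S_{n-1}$ outside a finite set, and let $$H_{n,d}=U_{n,d}\rtimes K_d,\qquad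 (hf)(v)=f(h^{-1}v).$$ $\mathrm{Aut}(T)$ carries the topology of pointwise convergence on the discrete set $V$ and $K_d$ the subspace topology; $U_{n,d}$ carries the group topology for which the subgroup $\mathfrak S_{n-1}^{V}$, with its product topology, is open; $H_{n,d}$ carries the product topology of $U_{n,d}$ and $K_d$. A topological group $G$ is *strongly amenable* if every proximal continuous action of $G$ on a non-empty compact Hausdorff space $X$ has a fixed point, where the action is *proximal* if the closure of every $G$-orbit in $X\times X$ meets the diagonal. A group is *ICC* if all its conjugacy classes other than that of the identity are infinite. A subgroup $\Gamma\le G$ is *cocompact* if $G/\Gamma$ is compact. **Proposition 3.4.** (1) Let $F\lneq F'\le\mathrm{Sym}(\Omega)$, where $F$ is semi-regular (has trivial point stabilizers) and $F'$ preserves every orbit of $F$, and let $n$ be the index of $F$ in $F'$. Then $K(F,F')$ is a countable ICC group, $H_{n,d}$ is a strongly amenable locally compact Hausdorff topological group, and there is an injective homomorphism $\varphi\colon K(F,F')\to H_{n,d}$ whose image is discrete and cocompact in $H_{n,d}$ and is not strongly amenable. (2) Consequently, strong amenability does not pass from a locally compact group to a discrete cocompact subgroup: there are a strongly amenable locally compact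 Hausdorff group $G$ and a discrete cocompact subgroup $\Gamma\le G$ such that $\Gamma$ is not strongly amenable. -/

import Mathlib

universe u v w

/-! ## Proximal actions and strong amenability -/

/-- The action of `G` on the topological space `X` is proximal: the closure in `X × X` of the orbit
of every point of `X × X` under the diagonal action meets the diagonal. -/
def IsProximalAction (G : Type*) [Group G] (X : Type*) [TopologicalSpace X] [MulAction G X] :
    Prop :=
  ∀ p : X × X, (closure (MulAction.orbit G p) ∩ Set.diagonal X).Nonempty

/-- A topological group `G` is strongly amenable if every proximal continuous action of `G` on a
non-empty compact Hausdorff space has a fixed point. -/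
def StronglyAmenable (G : Type v) [Group G] [TopologicalSpace G] : Prop :=
  ∀ (X : Type u) [TopologicalSpace X] [CompactSpace X] [T2Space X] [Nonempty X]
    [MulAction G X] [ContinuousSMul G X],
    IsProximalAction G X → ∃ x : X, ∀ g : G, g • x = x

/-- A group is ICC if every conjugacy class other than that of the identity is infinite. -/
def IsICC (G : Type*) [Group G] : Prop :=
  ∀ g : G, g ≠ 1 → (conjugatesOf g).Infinite

/-! ## Semi-restricted permutational wreath products -/

/-- The group `B^{X,A}` of functions `X → B` with values in `A` outside a finite set. -/
def semiRestricted (X : Type*) {B : Type*} [Group B] (A : Subgroup B) : Subgroup (X → B) where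
  carrier := {f | {x | f x ∉ A}.Finite}
  one_mem' := by simp [A.one_mem]
  mul_mem' := by
    intro f g hf hg
    refine (hf.union hg).subset fun x hx => ?_
    by_contra h
    simp only [Set.mem_union, Set.mem_ofPred_eq, not_or, not_not] at h
    exact hx (A.mul_mem h.1 h.2)
  inv_mem' := by
    intro f hf
    refine hf.subset fun x hx => ?_
    simpa using hx

/-- The left translate `f · W` in `B^{X,A}`, where `W` is the set of functions `X → A` that are
trivial on the finite set `S`. -/
def semiRestrictedNhd {X B : Type*} [Group B] {A : Subgroup B} (f : semiRestricted X A)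
    (S : Finset X) : Set (semiRestricted X A) :=
  {g | (∀ x, (f.1 x)⁻¹ * g.1 x ∈ A) ∧ ∀ x ∈ S, g.1 x = f.1 x}

/-- The topology on `B^{X,A}`, for `B` discrete: the translates of the basic identity neighbourhoods
of the product space `A^X` are a basis. -/
instance semiRestricted.instTopologicalSpace {X B : Type*} [Group B] {A : Subgroup B} :
    TopologicalSpace (semiRestricted X A) :=
  TopologicalSpace.generateFrom {U | ∃ f S, U = semiRestrictedNhd f S}

/-- The action `(h f)(x) = f (h⁻¹ x)` of `H` on `B^{X,A}` by group automorphisms. -/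
def semiRestrictedAction (X : Type*) {B : Type*} [Group B] (A : Subgroup B)
    (H : Type*) [Group H] [MulAction H X] : H →* MulAut (semiRestricted X A) where
  toFun h :=
    { toFun := fun f => ⟨fun x => f.1 (h⁻¹ • x),
        Set.Finite.preimage (MulAction.injective h⁻¹).injOn f.2⟩
      invFun := fun f => ⟨fun x => f.1 (h • x),
        Set.Finite.preimage (MulAction.injective h).injOn f.2⟩
      left_inv := fun f => by ext x; simp
      right_inv := fun f => by ext x; simp
      map_mul' := fun f g => rfl }
  map_one' := by ext f x; simp
  map_mul' h k := by ext f x; simp [mul_smul]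

/-- The semi-restricted permutational wreath product `B^{X,A} ⋊ H`. -/
abbrev SemiRestrictedWreath (X : Type*) {B : Type*} [Group B] (A : Subgroup B)
    (H : Type*) [Group H] [MulAction H X] : Type _ :=
  semiRestricted X A ⋊[semiRestrictedAction X A H] H

/-- The topology on `B^{X,A} ⋊ H` is the product topology of `B^{X,A}` and `H`. -/
instance SemiRestrictedWreath.instTopologicalSpace {X B : Type*} [Group B] {A : Subgroup B}
    {H : Type*} [Group H] [MulAction H X] [TopologicalSpace H] :
    TopologicalSpace (SemiRestrictedWreath X A H) :=
  TopologicalSpace.induced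
    (fun g => ((g.left, g.right) : semiRestricted X A × H)) inferInstance

/-! ## Coloured regular trees and their automorphisms -/

section Tree

variable {V Ω : Type*} {T : SimpleGraph V}

/-- The topology of pointwise convergence on `Aut(T)`, the vertex set being discrete. -/
instance SimpleGraph.autTopologicalSpace : TopologicalSpace (T ≃g T) :=
  TopologicalSpace.induced (fun g => (g : V → V)) (@Pi.topologicalSpace V (fun _ => V) fun _ => ⊥)

/-- An edge colouring such that, around every vertex, the colour is a bijection from the edges in
the star of that vertex onto the set of colours. -/
def IsLegalColoring (c : T.EdgeLabeling Ω) : Prop :=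
  ∀ v : V, Function.Bijective fun w : T.neighborSet v => c.get v w w.2

/-- The neighbours of `v` (that is, the edges of the star around `v`) identified with the
colours. -/
noncomputable def starEquiv {c : T.EdgeLabeling Ω} (hc : IsLegalColoring c) (v : V) :
    T.neighborSet v ≃ Ω :=
  Equiv.ofBijective _ (hc v)

/-- The local permutation `σ(g, v)` of the automorphism `g` at the vertex `v`: it sends the colour
of an edge `e` of the star around `v` to the colour of `g e`. -/
noncomputable def localPerm {c : T.EdgeLabeling Ω} (hc : IsLegalColoring c) (g : T ≃g T) (v : V) :
    Equiv.Perm Ω :=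
  (starEquiv hc v).symm.trans ((g.mapNeighborSet v).trans (starEquiv hc (g v)))

theorem localPerm_one {c : T.EdgeLabeling Ω} (hc : IsLegalColoring c) (v : V) :
    localPerm hc 1 v = 1 := by
  ext a
  exact (starEquiv hc v).apply_symm_apply a

theorem localPerm_mul {c : T.EdgeLabeling Ω} (hc : IsLegalColoring c) (g h : T ≃g T) (v : V) :
    localPerm hc (g * h) v = localPerm hc g (h v) * localPerm hc h v := by
  ext a
  simp only [localPerm, Equiv.trans_apply, Equiv.Perm.mul_apply, Equiv.symm_apply_apply]
  rfl

theorem localPerm_inv {c : T.EdgeLabeling Ω} (hc : IsLegalColoring c) (g : T ≃g T) (v : V) :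
    localPerm hc g⁻¹ v = (localPerm hc g (g⁻¹ v))⁻¹ := by
  have h := localPerm_mul hc g g⁻¹ v
  rw [mul_inv_cancel, localPerm_one] at h
  exact (inv_eq_of_mul_eq_one_right h.symm).symm

/-- The group `G(F, F')` of automorphisms of `T` whose local permutations are all in `F'`, and
are in `F` at all but finitely many vertices. -/
noncomputable def almostPrescribed {c : T.EdgeLabeling Ω} (hc : IsLegalColoring c)
    (F F' : Subgroup (Equiv.Perm Ω)) : Subgroup (T ≃g T) where
  carrier := {g | (∀ v, localPerm hc g v ∈ F') ∧ {v | localPerm hc g v ∉ F}.Finite}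
  one_mem' := by simp [localPerm_one, F.one_mem, F'.one_mem]
  mul_mem' := by
    rintro g h ⟨hg, hg'⟩ ⟨hh, hh'⟩
    refine ⟨fun v => by rw [localPerm_mul]; exact F'.mul_mem (hg _) (hh _), ?_⟩
    refine ((hg'.preimage h.injective.injOn).union hh').subset fun v hv => ?_
    by_contra hn
    simp only [Set.mem_union, Set.mem_preimage, Set.mem_ofPred_eq, not_or, not_not] at hn
    refine hv ?_
    rw [localPerm_mul]
    exact F.mul_mem hn.1 hn.2
  inv_mem' := by
    rintro g ⟨hg, hg'⟩
    refine ⟨fun v => by rw [localPerm_inv]; exact F'.inv_mem (hg _), ?_⟩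
    refine (hg'.preimage (g⁻¹ : T ≃g T).injective.injOn).subset fun v hv => ?_
    rw [Set.mem_ofPred_eq, localPerm_inv, F.inv_mem_iff] at hv
    exact hv

/-- The group `K(F, F')`, the stabilizer of the vertex `v₀` in `G(F, F')`. -/
noncomputable def vertexStabPrescribed {c : T.EdgeLabeling Ω} (hc : IsLegalColoring c)
    (F F' : Subgroup (Equiv.Perm Ω)) (v₀ : V) : Subgroup (T ≃g T) :=
  almostPrescribed hc F F' ⊓ MulAction.stabilizer (T ≃g T) v₀

/-- The group `H_{n,d} = 𝔖_n^{V, 𝔖_{n-1}} ⋊ K_d`, where `K_d` is the stabilizer of the vertex `v₀` in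
`Aut(T)` and `𝔖_{n-1}` is the stabilizer of `0` in `𝔖_n`. -/
abbrev WreathStab (T : SimpleGraph V) (v₀ : V) (n : ℕ) [NeZero n] : Type _ :=
  SemiRestrictedWreath V (MulAction.stabilizer (Equiv.Perm (Fin n)) (0 : Fin n))
    (MulAction.stabilizer (T ≃g T) v₀)

end Tree

/-! ## Permutation groups -/

/-- A permutation group is semi-regular if its point stabilizers are trivial. -/
def IsSemiRegular {Ω : Type*} (F : Subgroup (Equiv.Perm Ω)) : Prop :=
  ∀ a : Ω, MulAction.stabilizer F a = ⊥

/-- The permutation group `F'` preserves every orbit of `F`. -/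
def PreservesOrbits {Ω : Type*} (F' F : Subgroup (Equiv.Perm Ω)) : Prop :=
  ∀ σ ∈ F', ∀ a : Ω, σ a ∈ MulAction.orbit F a

/-!
The group `K(F, F')` is compared with `H_{n,d}` through the cocycle of local permutations: `g` is
mapped to the pair of `v ↦ σ(g, g⁻¹ v)`, acting on the `n` cosets of `F` in `F'`, and `g` itself
(`wreathEmbedding`). The image is discrete, as an automorphism with all local permutations in the
semi-regular group `F` is determined by its action around the root. It is cocompact, as an element
of `K(F, F')` can be built from the root outwards with local permutations in prescribed cosets of
`F` (`exists_mem_vertexStabPrescribed`); here the equality of the orbits of `F` and `F'` is used.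
The same construction, applied to a non-trivial point stabilizer of `F'`, gives elements
concentrated far away from the root, and conjugating by them shows that `K(F, F')` is ICC.

*Strong amenability of `H_{n,d}`* (`stronglyAmenable_wreath`). Proximality passes to cocompact
subsets, so that the functions that are trivial on a finite set `S` of vertices act proximally. If
`e` commutes with them and `(z, z)` is in the closure of their orbit of `(x, e x)`, then
`e z = z`. This gives a common fixed point of the functions supported on `S`, by compactness and
density one of `U_{n,d}`, and the latter is unique by proximality, hence fixed by all of
`H_{n,d}`.

*Failure for `K(F, F')`* (`IsICC.not_stronglyAmenable`). The group is the union of an increasing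
sequence of finite subgroups `L i`. After passing to a subsequence there are right
`L i`-equivariant maps `π i : L (i + 1) → L i` such that for every `k` there is `g` with
`π i (k g) = π i g`: a random equivariant map has this property, as infinite conjugacy classes
force every `k ≠ 1` to move at least half of the cosets of `L i` (`two_mul_card_fixed_cosets_le`),
so that the probability that there is no such `g` is exponentially small in the number of cosets,
and the number of `k` is only linear in it. The group acts on the sequences of compatible
equivariant maps `x i : G → L i` by translation. The coincidences make any two such sequences
agree on large sets after a translation, so the action is proximal, and there is no fixed point
since an equivariant map to the non-trivial group `L 0` is not constant.

For the second statement the first one is applied to `A₃ < S₃` and the tree of reduced words in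
three letters.
-/

/-! ### The topology of a semi-restricted power -/

section SemiRestricted

open Set Filter Topology

variable {X B : Type*} [Group B] {A : Subgroup B}

theorem mem_semiRestrictedNhd_self (f : semiRestricted X A) (S : Finset X) :
    f ∈ semiRestrictedNhd f S :=
  ⟨fun x => by simp [A.one_mem], fun _ _ => rfl⟩

theorem semiRestrictedNhd_eq_of_mem {f g : semiRestricted X A} {S : Finset X}
    (h : g ∈ semiRestrictedNhd f S) : semiRestrictedNhd f S = semiRestrictedNhd g S := by
  ext k
  refine and_congr (forall_congr' fun x => ?_) (forall₂_congr fun x hx => ?_)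
  · have : (f.1 x)⁻¹ * k.1 x = ((f.1 x)⁻¹ * g.1 x) * ((g.1 x)⁻¹ * k.1 x) := by group
    rw [this, A.mul_mem_cancel_left (h.1 x)]
  · rw [h.2 x hx]

theorem isOpen_semiRestrictedNhd (f : semiRestricted X A) (S : Finset X) :
    IsOpen (semiRestrictedNhd f S) :=
  TopologicalSpace.isOpen_generateFrom_of_mem ⟨f, S, rfl⟩

theorem semiRestricted_hasBasis_nhds (f : semiRestricted X A) :
    (𝓝 f).HasBasis (fun _ : Finset X => True) (semiRestrictedNhd f) := by
  classical
  -- the supersets of the basic sets around `f` form a filter `l`, which contains every generating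
  -- set that contains `f`
  refine ⟨fun t => ⟨fun ht => ?_, fun ⟨S, _, hS⟩ =>
    mem_of_superset ((isOpen_semiRestrictedNhd f S).mem_nhds (mem_semiRestrictedNhd_self f S)) hS⟩⟩
  have hanti : ∀ {S S' : Finset X}, S ⊆ S' → semiRestrictedNhd f S' ⊆ semiRestrictedNhd f S :=
    fun h g hg => ⟨hg.1, fun x hx => hg.2 x (h hx)⟩
  rw [TopologicalSpace.nhds_generateFrom] at ht
  let l : Filter (semiRestricted X A) :=
    { sets := {s | ∃ S, semiRestrictedNhd f S ⊆ s}
      univ_sets := ⟨∅, subset_univ _⟩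
      sets_of_superset := fun ⟨S, hS⟩ h => ⟨S, hS.trans h⟩
      inter_sets := fun ⟨S, hS⟩ ⟨S', hS'⟩ => ⟨S ∪ S', subset_inter
        ((hanti Finset.subset_union_left).trans hS) ((hanti Finset.subset_union_right).trans hS')⟩ }
  suffices h : l ≤ ⨅ s ∈ {s | f ∈ s ∧ s ∈ {U | ∃ f S, U = semiRestrictedNhd (X := X) (A := A) f S}},
      𝓟 s by
    obtain ⟨S, hS⟩ := h ht
    exact ⟨S, trivial, hS⟩
  refine le_iInf₂ fun s hs => ?_
  obtain ⟨hfs, g, S, rfl⟩ := hs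
  exact le_principal_iff.2 ⟨S, (semiRestrictedNhd_eq_of_mem hfs).symm.subset⟩

/-- The finite set of points at which a semi-restricted function leaves the subgroup. -/
noncomputable def semiRestrictedSupport (f : semiRestricted X A) : Finset X :=
  Set.Finite.toFinset (s := {x | f.1 x ∉ A}) f.2

theorem mem_of_notMem_semiRestrictedSupport {f : semiRestricted X A} {x : X}
    (h : x ∉ semiRestrictedSupport f) : f.1 x ∈ A := by
  by_contra hx
  exact h ((Set.Finite.mem_toFinset _).2 hx)

instance semiRestricted.instIsTopologicalGroup : IsTopologicalGroup (semiRestricted X A) where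
  continuous_mul := by
    classical
    rw [continuous_iff_continuousAt]
    rintro ⟨f, g⟩
    refine (((semiRestricted_hasBasis_nhds f).prod_nhds
      (semiRestricted_hasBasis_nhds g)).tendsto_iff (semiRestricted_hasBasis_nhds (f * g))).2
      fun S _ => ⟨(S ∪ semiRestrictedSupport g, S), ⟨trivial, trivial⟩, ?_⟩
    rintro ⟨f', g'⟩ ⟨hf, hg⟩
    refine ⟨fun x => ?_, fun x hx => ?_⟩
    · have e : ((f * g).1 x)⁻¹ * (f' * g').1 x
          = (g.1 x)⁻¹ * ((f.1 x)⁻¹ * f'.1 x) * g.1 x * ((g.1 x)⁻¹ * g'.1 x) := by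
        simp only [Subgroup.coe_mul, Pi.mul_apply]; group
      rw [e]
      refine A.mul_mem ?_ (hg.1 x)
      by_cases hx : x ∈ semiRestrictedSupport g
      · have := hf.2 x (Finset.mem_union_right _ hx)
        dsimp only at this
        rw [this]; simp [A.one_mem]
      · have := mem_of_notMem_semiRestrictedSupport hx
        exact A.mul_mem (A.mul_mem (A.inv_mem this) (hf.1 x)) this
    · have h1 := hf.2 x (Finset.mem_union_left _ hx)
      have h2 := hg.2 x hx
      simp only [Subgroup.coe_mul, Pi.mul_apply] at h1 h2 ⊢
      rw [h1, h2]
  continuous_inv := by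
    classical
    rw [continuous_iff_continuousAt]
    intro f
    refine ((semiRestricted_hasBasis_nhds f).tendsto_iff (semiRestricted_hasBasis_nhds f⁻¹)).2
      fun S _ => ⟨S ∪ semiRestrictedSupport f, trivial, fun f' hf => ⟨fun x => ?_, fun x hx => ?_⟩⟩
    · by_cases hx : x ∈ semiRestrictedSupport f
      · have := hf.2 x (Finset.mem_union_right _ hx)
        simp [this, A.one_mem]
      · have h1 := mem_of_notMem_semiRestrictedSupport hx
        have h2 := (A.mul_mem_cancel_left (A.inv_mem h1)).1 (hf.1 x)
        simpa using A.mul_mem h1 (A.inv_mem h2)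
    · have := hf.2 x (Finset.mem_union_left _ hx)
      simp [this]

theorem isLocallyConstant_semiRestricted_apply (x : X) :
    IsLocallyConstant fun f : semiRestricted X A => f.1 x := by
  rw [IsLocallyConstant.iff_eventually_eq]
  intro f
  filter_upwards [(semiRestricted_hasBasis_nhds f).mem_of_mem (i := {x}) trivial] with g hg
  exact hg.2 x (by simp)

instance semiRestricted.instT2Space : T2Space (semiRestricted X A) := by
  refine ⟨fun f g hfg => ?_⟩
  obtain ⟨x, hx⟩ : ∃ x, f.1 x ≠ g.1 x := by
    by_contra! h
    exact hfg (Subtype.ext (funext h))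
  refine ⟨{k | k.1 x = f.1 x}, {k | k.1 x = g.1 x},
    (isLocallyConstant_semiRestricted_apply x).isOpen_fiber _,
    (isLocallyConstant_semiRestricted_apply x).isOpen_fiber _, rfl, rfl, ?_⟩
  rw [Set.disjoint_left]
  intro k hk hk'
  exact hx (hk.symm.trans hk')

/-- The compact open subgroup `A^X` of `B^{X,A}`. -/
def semiRestrictedBase (X : Type*) {B : Type*} [Group B] (A : Subgroup B) :
    Set (semiRestricted X A) :=
  {f | ∀ x, f.1 x ∈ A}

theorem isOpen_semiRestrictedBase : IsOpen (semiRestrictedBase X A) := by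
  convert isOpen_semiRestrictedNhd (1 : semiRestricted X A) ∅ using 1
  ext f
  simp [semiRestrictedBase, semiRestrictedNhd]

theorem isCompact_semiRestrictedBase [Finite B] : IsCompact (semiRestrictedBase X A) := by
  let _ : TopologicalSpace A := ⊥
  have : DiscreteTopology A := ⟨rfl⟩
  let F : (X → A) → semiRestricted X A := fun f => ⟨fun x => f x, by
    have : {x | ((f x : A) : B) ∉ A} = ∅ := by simp
    change Set.Finite {x | ((f x : A) : B) ∉ A}
    rw [this]; exact Set.finite_empty⟩
  have hF : Continuous F := by
    rw [continuous_iff_continuousAt]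
    intro f
    refine (semiRestricted_hasBasis_nhds (F f)).tendsto_right_iff.2 fun S _ => ?_
    have : ∀ᶠ g in 𝓝 f, ∀ x ∈ S, g x = f x := by
      rw [Filter.eventually_all_finset]
      intro x _
      have ho : IsOpen {g : X → A | g x = f x} :=
        (isOpen_discrete {f x}).preimage (f := fun g : X → A => g x) (continuous_apply x)
      exact ho.mem_nhds rfl
    filter_upwards [this] with g hg
    exact ⟨fun x => A.mul_mem (A.inv_mem (f x).2) (g x).2, fun x hx => by simp [F, hg x hx]⟩
  have : semiRestrictedBase X A = range F := by
    ext f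
    constructor
    · intro hf
      exact ⟨fun x => ⟨f.1 x, hf x⟩, rfl⟩
    · rintro ⟨g, rfl⟩ x
      exact (g x).2
  rw [this]
  exact isCompact_range hF

end SemiRestricted

/-! ### The topology of a semi-restricted wreath product -/

section Wreath

open Set Filter Topology

variable {X B : Type*} [Group B] {A : Subgroup B} {H : Type*} [Group H] [MulAction H X]

@[simp]
theorem semiRestrictedAction_apply (h : H) (f : semiRestricted X A) (x : X) :
    (semiRestrictedAction X A H h f).1 x = f.1 (h⁻¹ • x) :=
  rfl

variable [TopologicalSpace H]

theorem continuous_semiRestrictedAction (hH : ∀ x y : X, IsOpen {h : H | h • x = y}) :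
    Continuous fun p : H × semiRestricted X A => semiRestrictedAction X A H p.1 p.2 := by
  classical
  rw [continuous_iff_continuousAt]
  rintro ⟨h, f⟩
  refine (semiRestricted_hasBasis_nhds _).tendsto_right_iff.2 fun S _ => ?_
  have h1 : ∀ᶠ p : H × semiRestricted X A in 𝓝 (h, f),
      ∀ x ∈ semiRestrictedSupport f ∪ S.image (fun x => h⁻¹ • x), p.1 • x = h • x := by
    rw [Filter.eventually_all_finset]
    intro x _
    have ho : IsOpen {p : H × semiRestricted X A | p.1 • x = h • x} :=
      (hH x (h • x)).preimage continuous_fst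
    exact ho.mem_nhds rfl
  have h2 : ∀ᶠ p : H × semiRestricted X A in 𝓝 (h, f),
      p.2 ∈ semiRestrictedNhd f (S.image fun x => h⁻¹ • x) :=
    continuous_snd.continuousAt.eventually
      ((isOpen_semiRestrictedNhd f _).mem_nhds (mem_semiRestrictedNhd_self f _))
  filter_upwards [h1, h2] with ⟨k, g⟩ hk hg
  dsimp only at hk hg
  refine ⟨fun x => ?_, fun x hx => ?_⟩
  · simp only [semiRestrictedAction_apply]
    by_cases hx : h⁻¹ • x ∈ semiRestrictedSupport f
    · have : k⁻¹ • x = h⁻¹ • x := by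
        rw [inv_smul_eq_iff, hk _ (Finset.mem_union_left _ hx), smul_inv_smul]
      rw [this]
      exact hg.1 _
    · have hx' : k⁻¹ • x ∉ semiRestrictedSupport f := fun hx' => by
        have := hk _ (Finset.mem_union_left _ hx')
        rw [smul_inv_smul] at this
        rw [this, inv_smul_smul] at hx
        exact hx hx'
      refine A.mul_mem (A.inv_mem (mem_of_notMem_semiRestrictedSupport hx)) ?_
      exact (A.mul_mem_cancel_left
        (A.inv_mem (mem_of_notMem_semiRestrictedSupport hx'))).1 (hg.1 _)
  · have hm : h⁻¹ • x ∈ S.image (fun x => h⁻¹ • x) := Finset.mem_image_of_mem _ hx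
    have : k⁻¹ • x = h⁻¹ • x := by
      rw [inv_smul_eq_iff, hk _ (Finset.mem_union_right _ hm), smul_inv_smul]
    simp only [semiRestrictedAction_apply, this]
    exact hg.2 _ hm

/-- The homeomorphism of `B^{X,A} ⋊ H` with the product space. -/
def wreathHomeomorph (X : Type*) {B : Type*} [Group B] (A : Subgroup B) (H : Type*) [Group H]
    [MulAction H X] [TopologicalSpace H] :
    SemiRestrictedWreath X A H ≃ₜ semiRestricted X A × H where
  toEquiv := SemidirectProduct.equivProd
  continuous_toFun := continuous_induced_dom
  continuous_invFun := continuous_induced_rng.2 continuous_id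

theorem continuous_wreath_left :
    Continuous fun g : SemiRestrictedWreath X A H => g.left :=
  continuous_fst.comp (wreathHomeomorph X A H).continuous

theorem continuous_wreath_right :
    Continuous fun g : SemiRestrictedWreath X A H => g.right :=
  continuous_snd.comp (wreathHomeomorph X A H).continuous

theorem continuous_wreath_mk :
    Continuous fun p : semiRestricted X A × H => (⟨p.1, p.2⟩ : SemiRestrictedWreath X A H) :=
  (wreathHomeomorph X A H).symm.continuous

theorem continuous_wreath_inl :
    Continuous (SemidirectProduct.inl : semiRestricted X A → SemiRestrictedWreath X A H) :=
  continuous_wreath_mk.comp (continuous_id.prodMk continuous_const)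

theorem continuous_wreath_inr :
    Continuous (SemidirectProduct.inr : H → SemiRestrictedWreath X A H) :=
  continuous_wreath_mk.comp (continuous_const.prodMk continuous_id)

theorem isTopologicalGroup_wreath [IsTopologicalGroup H]
    (hH : ∀ x y : X, IsOpen {h : H | h • x = y}) :
    IsTopologicalGroup (SemiRestrictedWreath X A H) := by
  have hact := continuous_semiRestrictedAction (A := A) hH
  refine { continuous_mul := ?_, continuous_inv := ?_ }
  · refine continuous_wreath_mk.comp (Continuous.prodMk (Continuous.mul ?_ ?_)
      (Continuous.mul ?_ ?_))
    · exact continuous_wreath_left.comp continuous_fst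
    · exact hact.comp ((continuous_wreath_right.comp continuous_fst).prodMk
        (continuous_wreath_left.comp continuous_snd))
    · exact continuous_wreath_right.comp continuous_fst
    · exact continuous_wreath_right.comp continuous_snd
  · refine continuous_wreath_mk.comp (Continuous.prodMk ?_ continuous_wreath_right.inv)
    exact hact.comp (continuous_wreath_right.inv.prodMk continuous_wreath_left.inv)

theorem t2Space_wreath [T2Space H] : T2Space (SemiRestrictedWreath X A H) :=
  (wreathHomeomorph X A H).symm.t2Space

/-- The subset `A^X ⋊ H` of `B^{X,A} ⋊ H`. -/
def wreathBase (X : Type*) {B : Type*} [Group B] (A : Subgroup B) (H : Type*) [Group H]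
    [MulAction H X] : Set (SemiRestrictedWreath X A H) :=
  {g | g.left ∈ semiRestrictedBase X A}

theorem isOpen_wreathBase : IsOpen (wreathBase X A H) :=
  isOpen_semiRestrictedBase.preimage continuous_wreath_left

theorem isCompact_wreathBase [Finite B] [CompactSpace H] : IsCompact (wreathBase X A H) := by
  have : wreathBase X A H =
      (wreathHomeomorph X A H) ⁻¹' (semiRestrictedBase X A ×ˢ Set.univ) := by
    ext g
    simp [wreathBase, wreathHomeomorph, SemidirectProduct.equivProd]
  rw [this, Homeomorph.isCompact_preimage]
  exact isCompact_semiRestrictedBase.prod isCompact_univ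

theorem locallyCompactSpace_wreath [Finite B] [CompactSpace H] [IsTopologicalGroup H]
    (hH : ∀ x y : X, IsOpen {h : H | h • x = y}) :
    LocallyCompactSpace (SemiRestrictedWreath X A H) := by
  have := isTopologicalGroup_wreath (A := A) hH
  refine isCompact_wreathBase.locallyCompactSpace_of_mem_nhds_of_group
    (x := (1 : SemiRestrictedWreath X A H)) (isOpen_wreathBase.mem_nhds fun x => ?_)
  exact A.one_mem

end Wreath

/-! ### Proximal actions -/

section Proximal

open Set Filter Topology

variable {G X : Type*} [Group G] [TopologicalSpace X] [MulAction G X]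

/-- Proximality passes to a subset `N` of `G` with `G = C N` for a compact `C`. -/
theorem IsProximalAction.exists_mem_closure [TopologicalSpace G] [ContinuousSMul G X] [T2Space X]
    [CompactSpace X] (hX : IsProximalAction G X) {C N : Set G} (hC : IsCompact C)
    (hCN : ∀ g : G, ∃ c ∈ C, ∃ k ∈ N, g = c * k) (p : X × X) :
    ∃ z : X, (z, z) ∈ closure ((fun g : G => g • p) '' N) := by
  set Y := closure ((fun g : G => g • p) '' N)
  have hY : IsCompact Y := isClosed_closure.isCompact
  have hCY : IsClosed ((fun q : G × (X × X) => q.1 • q.2) '' (C ×ˢ Y)) :=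
    ((hC.prod hY).image continuous_smul).isClosed
  have horb : MulAction.orbit G p ⊆ (fun q : G × (X × X) => q.1 • q.2) '' (C ×ˢ Y) := by
    rintro _ ⟨g, rfl⟩
    obtain ⟨c, hc, k, hk, rfl⟩ := hCN g
    exact ⟨(c, k • p), ⟨hc, subset_closure ⟨k, hk, rfl⟩⟩, (mul_smul c k p).symm⟩
  obtain ⟨q, hq, hqd⟩ := hX p
  obtain ⟨⟨c, ⟨y, y'⟩⟩, ⟨-, hy⟩, rfl⟩ := closure_minimal horb hCY hq
  have : y = y' := by
    simpa [Set.diagonal] using hqd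
  subst this
  exact ⟨y, hy⟩

/-- Finitely many elements that commute with a subset acting proximally have a common fixed
point. -/
theorem exists_forall_mem_smul_eq [T2Space X] [Nonempty X] [ContinuousConstSMul G X] {N : Set G}
    (hN : ∀ p : X × X, ∃ z : X, (z, z) ∈ closure ((fun g : G => g • p) '' N)) (E : Finset G)
    (hE : ∀ e ∈ E, ∀ k ∈ N, Commute e k) : ∃ x : X, ∀ e ∈ E, e • x = x := by
  classical
  induction E using Finset.induction_on with
  | empty => exact ⟨Classical.arbitrary X, by simp⟩
  | insert e E _ ih =>
    obtain ⟨x, hx⟩ := ih fun e he => hE e (Finset.mem_insert_of_mem he)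
    obtain ⟨z, hz⟩ := hN (x, e • x)
    have hcl : IsClosed {p : X × X | e • p.1 = p.2 ∧ ∀ e' ∈ E, e' • p.1 = p.1} := by
      refine (isClosed_eq (by fun_prop) (by fun_prop)).inter ?_
      have : {p : X × X | ∀ e' ∈ E, e' • p.1 = p.1} = ⋂ e' ∈ E, {p : X × X | e' • p.1 = p.1} := by
        ext; simp
      change IsClosed {p : X × X | ∀ e' ∈ E, e' • p.1 = p.1}
      rw [this]
      exact isClosed_biInter fun e' _ => isClosed_eq (by fun_prop) (by fun_prop)
    have hsub : (fun g : G => g • (x, e • x)) '' N ⊆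
        {p : X × X | e • p.1 = p.2 ∧ ∀ e' ∈ E, e' • p.1 = p.1} := by
      rintro _ ⟨k, hk, rfl⟩
      refine ⟨?_, fun e' he' => ?_⟩
      · simp only [Prod.smul_mk, smul_smul, (hE e (Finset.mem_insert_self e E) k hk).eq]
      · simp only [Prod.smul_mk]
        rw [smul_smul, (hE e' (Finset.mem_insert_of_mem he') k hk).eq, mul_smul, hx e' he']
    have := closure_minimal hsub hcl hz
    refine ⟨z, fun e' he' => ?_⟩
    rcases Finset.mem_insert.1 he' with rfl | he'
    · exact this.1
    · exact this.2 e' he'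

end Proximal

/-! ### Strong amenability of semi-restricted wreath products -/

section WreathAmenable

open Set Filter Topology Pointwise

variable {X B : Type*} [Group B] {A : Subgroup B}

open Classical in
/-- The restriction of a semi-restricted function to the finite set `S`, extended by `1`. -/
noncomputable def semiRestrictedCut (S : Finset X) (f : semiRestricted X A) :
    semiRestricted X A :=
  ⟨fun x => if x ∈ S then f.1 x else 1, S.finite_toSet.subset fun x hx => by
    by_contra h
    have hxS : x ∉ S := h
    exact hx (by simp [hxS, A.one_mem])⟩

theorem semiRestrictedCut_apply_of_mem {S : Finset X} {x : X} (hx : x ∈ S)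
    (f : semiRestricted X A) : (semiRestrictedCut S f).1 x = f.1 x := by
  simp [semiRestrictedCut, hx]

theorem semiRestrictedCut_apply_of_notMem {S : Finset X} {x : X} (hx : x ∉ S)
    (f : semiRestricted X A) : (semiRestrictedCut S f).1 x = 1 := by
  simp [semiRestrictedCut, hx]

theorem dense_finite_support : Dense {f : semiRestricted X A | {x | f.1 x ≠ 1}.Finite} := by
  classical
  intro f
  rw [mem_closure_iff_nhds_basis (semiRestricted_hasBasis_nhds f)]
  intro S _
  refine ⟨semiRestrictedCut (S ∪ semiRestrictedSupport f) f, ?_, fun x => ?_, fun x hx => ?_⟩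
  · refine (S ∪ semiRestrictedSupport f).finite_toSet.subset fun x hx => ?_
    by_contra h
    exact hx (semiRestrictedCut_apply_of_notMem h f)
  · by_cases hx : x ∈ S ∪ semiRestrictedSupport f
    · rw [semiRestrictedCut_apply_of_mem hx]; simp [A.one_mem]
    · rw [semiRestrictedCut_apply_of_notMem hx, mul_one]
      refine A.inv_mem (mem_of_notMem_semiRestrictedSupport fun h => hx ?_)
      exact Finset.mem_union_right _ h
  · exact semiRestrictedCut_apply_of_mem (Finset.mem_union_left _ hx) f

theorem finite_range_semiRestrictedCut [Finite B] (S : Finset X) :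
    (range (semiRestrictedCut (A := A) S)).Finite := by
  have : Function.Injective fun (f : range (semiRestrictedCut (A := A) S)) (x : S) =>
      f.1.1 x := by
    rintro ⟨_, f, rfl⟩ ⟨_, g, rfl⟩ h
    ext x
    by_cases hx : x ∈ S
    · exact congrFun h ⟨x, hx⟩
    · simp only [semiRestrictedCut_apply_of_notMem hx]
  exact Finite.of_injective _ this

variable {H : Type*} [Group H] [MulAction H X] [TopologicalSpace H]

/-- For every finite `S ⊆ X`, the functions that are trivial on `S` act proximally, as they form a
cocompact subset, and they commute with the finite group of functions supported on `S`. Hence all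
finitely supported functions have a common fixed point, which is a fixed point of `B^{X,A}` by
density, and it is the only one, so that it is fixed by the whole group. -/
theorem stronglyAmenable_wreath [Finite B] [CompactSpace H] [IsTopologicalGroup H]
    (hH : ∀ x y : X, IsOpen {h : H | h • x = y}) :
    StronglyAmenable.{u} (SemiRestrictedWreath X A H) := by
  classical
  intro Z _ _ _ _ _ _ hZ
  have := isTopologicalGroup_wreath (A := A) hH
  let inl : semiRestricted X A →* SemiRestrictedWreath X A H := SemidirectProduct.inl
  let inr : H →* SemiRestrictedWreath X A H := SemidirectProduct.inr
  have hprox : ∀ (S : Finset X) (p : Z × Z), ∃ z : Z, (z, z) ∈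
      closure ((fun g : SemiRestrictedWreath X A H => g • p) ''
        (inl '' {f | ∀ x ∈ S, f.1 x = 1})) := by
    intro S p
    refine hZ.exists_mem_closure (C := range inr * inl '' (range (semiRestrictedCut S))) ?_ ?_ p
    · exact (isCompact_range continuous_wreath_inr).mul
        ((finite_range_semiRestrictedCut S).image inl).isCompact
    · intro g
      set f := semiRestrictedAction X A H g.right⁻¹ g.left with hf
      refine ⟨inr g.right * inl (semiRestrictedCut S f),
        mul_mem_mul (mem_range_self _) (mem_image_of_mem _ (mem_range_self _)),
        inl ((semiRestrictedCut S f)⁻¹ * f), mem_image_of_mem _ fun x hx => ?_, ?_⟩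
      · simp [semiRestrictedCut_apply_of_mem hx]
      · rw [mul_assoc, ← map_mul, mul_inv_cancel_left]
        ext : 1
        · simp [inl, inr, hf]
        · simp [inl, inr]
  -- a common fixed point of the finitely supported functions
  obtain ⟨z, hz⟩ : ∃ z : Z, ∀ f : semiRestricted X A, {x | f.1 x ≠ 1}.Finite → inl f • z = z := by
    have key := isCompact_univ.inter_iInter_nonempty
      (fun f : {f : semiRestricted X A // {x | f.1 x ≠ 1}.Finite} => {z : Z | inl f.1 • z = z})
      (fun f => isClosed_eq (continuous_const_smul _) continuous_id) ?_
    · obtain ⟨z, -, hz⟩ := key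
      exact ⟨z, fun f hf => mem_iInter.1 hz ⟨f, hf⟩⟩
    · intro E
      obtain ⟨z, hz⟩ := exists_forall_mem_smul_eq (hprox (E.biUnion fun f => f.2.toFinset))
        (E.image fun f => inl f.1) (by
          simp only [Finset.mem_image, forall_exists_index, and_imp]
          rintro _ f hf rfl _ ⟨k, hk, rfl⟩
          refine Commute.map (Subtype.ext (funext fun x => ?_)) inl
          by_cases hx : f.1.1 x = 1
          · simp [hx]
          · have := hk x (Finset.mem_biUnion.2 ⟨f, hf, (Set.Finite.mem_toFinset _).2 hx⟩)
            simp [this])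
      refine ⟨z, trivial, mem_iInter₂.2 fun f hf => hz _ (Finset.mem_image_of_mem _ hf)⟩
  -- by density it is fixed by the whole normal subgroup
  have hz' : ∀ f : semiRestricted X A, inl f • z = z := by
    have hcl : IsClosed {f : semiRestricted X A | inl f • z = z} :=
      isClosed_eq (Continuous.smul continuous_wreath_inl continuous_const) continuous_const
    intro f
    exact hcl.closure_subset_iff.2 (fun f hf => hz f hf) (dense_finite_support f)
  refine ⟨z, fun g => ?_⟩
  -- the point `g • z` is fixed by the normal subgroup too, so that it equals `z` by proximality
  have hg : ∀ f : semiRestricted X A, inl f • g • z = g • z := by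
    intro f
    have : inl f * g = g * inl (semiRestrictedAction X A H g.right⁻¹ (g.left⁻¹ * f * g.left)) := by
      ext : 1
      · simp [inl, mul_assoc]
      · simp [inl]
    rw [smul_smul, this, mul_smul, hz']
  obtain ⟨y, hy⟩ := hprox ∅ (z, g • z)
  have hsub : (fun k : SemiRestrictedWreath X A H => k • (z, g • z)) ''
      (inl '' {f | ∀ x ∈ (∅ : Finset X), f.1 x = 1}) ⊆ {(z, g • z)} := by
    rintro _ ⟨_, ⟨f, -, rfl⟩, rfl⟩
    simp only [Prod.smul_mk, hz', hg, mem_singleton_iff]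
  have := closure_minimal hsub isClosed_singleton hy
  simp only [mem_singleton_iff, Prod.mk.injEq] at this
  exact this.2.symm.trans this.1

end WreathAmenable

/-! ### Counting functions with coincidences -/

section Counting

open Finset

/-- A permutation has a set `I` of at least a third of its non-fixed points that is disjoint from
its image. -/
theorem exists_disjoint_image_perm {Q : Type*} [Fintype Q] [DecidableEq Q] (τ : Equiv.Perm Q) :
    ∃ I : Finset Q, Disjoint I (I.image τ) ∧ #{q | τ q ≠ q} ≤ 3 * #I := by
  obtain ⟨I, hI⟩ := (Set.toFinite {I : Finset Q | Disjoint I (I.image τ)}).exists_maximal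
    ⟨∅, by simp⟩
  have hdisj : Disjoint I (I.image τ) := hI.1
  have hI' : ∀ q ∈ I, τ q ∉ I := fun q hq hτ =>
    Finset.disjoint_left.1 hdisj hτ (Finset.mem_image_of_mem _ hq)
  refine ⟨I, hdisj, ?_⟩
  have hsub : ({q | τ q ≠ q} : Finset Q) ⊆ I ∪ I.image τ ∪ I.image τ.symm := by
    intro q hq
    by_contra h
    simp only [mem_union, mem_image, not_or, not_exists, not_and, mem_filter, mem_univ,
      true_and] at h hq
    refine h.1.1 (hI.2 (y := insert q I) ?_ (Finset.subset_insert q I) (mem_insert_self q I))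
    change Disjoint _ _
    rw [Finset.disjoint_left]
    intro x hx hx'
    obtain ⟨y, hy, rfl⟩ := mem_image.1 hx'
    rcases mem_insert.1 hx with hx₁ | hx₁ <;> rcases mem_insert.1 hy with hy₁ | hy₁
    · exact hq (hy₁ ▸ hx₁)
    · exact h.1.2 y hy₁ hx₁
    · exact h.2 _ hx₁ (by rw [hy₁, τ.symm_apply_apply])
    · exact hI' y hy₁ hx₁
  calc _ ≤ _ := card_le_card hsub
    _ ≤ #I + #(I.image τ) + #(I.image τ.symm) :=
      (card_union_le _ _).trans (Nat.add_le_add_right (card_union_le _ _) _)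
    _ ≤ #I + #I + #I := Nat.add_le_add (Nat.add_le_add le_rfl card_image_le) card_image_le
    _ = 3 * #I := by ring

/-- If `I` is disjoint from its image under `τ`, then the values on `I` of a random function `ζ`
avoid those prescribed by the composite of `ζ` with `τ` with probability at most
`(1 - 1 / |A|) ^ |I|`. -/
theorem card_filter_forall_ne_le {Q A : Type*} [Fintype Q] [DecidableEq Q] [Group A] [Fintype A]
    [DecidableEq A] (τ : Equiv.Perm Q) (c : Q → A) (I : Finset Q) (hI : Disjoint I (I.image τ)) :
    (#{ζ : Q → A | ∀ q ∈ I, ζ (τ q) * c q ≠ ζ q} : ℝ) ≤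
      (Fintype.card A : ℝ) ^ Fintype.card Q *
        (((Fintype.card A : ℝ) - 1) / Fintype.card A) ^ #I := by
  have hI' : ∀ q ∈ I, τ q ∉ I := fun q hq hτ =>
    Finset.disjoint_left.1 hI hτ (Finset.mem_image_of_mem _ hq)
  have hle : #{ζ : Q → A | ∀ q ∈ I, ζ (τ q) * c q ≠ ζ q} ≤
      #(Fintype.piFinset fun q => if q ∈ I then (univ : Finset A).erase 1 else univ) := by
    -- the substitution `ζ q ↦ (ζ (τ q) c q)⁻¹ ζ q` on `I` turns the condition into `ζ q ≠ 1`
    refine card_le_card_of_injOn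
      (fun ζ q => if q ∈ I then (ζ (τ q) * c q)⁻¹ * ζ q else ζ q) ?_ ?_
    · intro ζ hζ
      simp only [coe_filter, mem_univ, true_and, Set.mem_ofPred_eq] at hζ
      simp only [Finset.mem_coe, Fintype.mem_piFinset]
      intro q
      split_ifs with hq
      · simp only [mem_erase, mem_univ, and_true, ne_eq, inv_mul_eq_one]
        exact hζ q hq
      · exact mem_univ _
    · intro ζ _ ζ' _ h
      have hout : ∀ q ∉ I, ζ q = ζ' q := fun q hq => by simpa [hq] using congrFun h q
      funext q
      by_cases hq : q ∈ I
      · have := congrFun h q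
        simp only [hq, if_true, hout _ (hI' q hq)] at this
        exact mul_left_cancel this
      · exact hout q hq
  have ha : (Fintype.card A : ℝ) ≠ 0 := by simp
  have h1 : 1 ≤ Fintype.card A := Fintype.card_pos
  calc (#{ζ : Q → A | ∀ q ∈ I, ζ (τ q) * c q ≠ ζ q} : ℝ) ≤ _ := Nat.cast_le.2 hle
    _ = ∏ q : Q, ((Fintype.card A : ℝ) *
          if q ∈ I then ((Fintype.card A : ℝ) - 1) / Fintype.card A else 1) := by
      rw [Fintype.card_piFinset, Nat.cast_prod]
      refine prod_congr rfl fun q _ => ?_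
      split_ifs with hq
      · rw [card_erase_of_mem (mem_univ _), card_univ, Nat.cast_sub h1, mul_div_cancel₀ _ ha,
          Nat.cast_one]
      · rw [card_univ, mul_one]
    _ = _ := by
      rw [prod_mul_distrib, prod_const, card_univ, prod_ite_mem, univ_inter, prod_const]

theorem exists_forall_mul_pow_lt_one {r a : ℝ} (hr : 0 ≤ r) (hr1 : r < 1) :
    ∃ n₀ : ℕ, ∀ n ≥ n₀, a * n * r ^ (n / 6) < 1 := by
  have h1 := tendsto_self_mul_const_pow_of_lt_one hr hr1
  have h2 := tendsto_pow_atTop_nhds_zero_of_lt_one hr hr1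
  have h3 : Filter.Tendsto (fun m : ℕ => |a| * (6 * ((m : ℝ) * r ^ m) + 5 * r ^ m)) Filter.atTop
      (nhds (|a| * (6 * 0 + 5 * 0))) :=
    ((h1.const_mul 6).add (h2.const_mul 5)).const_mul |a|
  have h4 := h3.eventually_lt_const (u := 1) (by norm_num)
  obtain ⟨m₀, hm₀⟩ := Filter.eventually_atTop.1 h4
  refine ⟨6 * m₀, fun n hn => lt_of_le_of_lt ?_ (hm₀ (n / 6) (by omega))⟩
  have hn' : (n : ℝ) ≤ 6 * ((n / 6 : ℕ) : ℝ) + 5 := by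
    exact_mod_cast (by omega : n ≤ 6 * (n / 6) + 5)
  have hp : 0 ≤ r ^ (n / 6) := pow_nonneg hr _
  calc a * n * r ^ (n / 6) ≤ |a| * n * r ^ (n / 6) := by gcongr; exact le_abs_self a
    _ ≤ |a| * (6 * ((n / 6 : ℕ) : ℝ) + 5) * r ^ (n / 6) := by gcongr
    _ = _ := by ring

/-- If every non-trivial element of the finite group `M` moves at least half of the cosets of the
subgroup `A`, and `A` has large index, then a random right `A`-equivariant map `θ : M → A` has, for
every `k`, a coincidence `θ (k g) = θ g`. -/
theorem exists_equivariant_coincidence {M : Type*} [Group M] [Finite M] (A : Subgroup M)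
    (hmove : ∀ k : M, k ≠ 1 → 2 * Nat.card {q : M ⧸ A | k • q = q} ≤ Nat.card (M ⧸ A))
    (hbig : (Nat.card A : ℝ) * Nat.card (M ⧸ A) *
      (((Nat.card A : ℝ) - 1) / Nat.card A) ^ (Nat.card (M ⧸ A) / 6) < 1) :
    ∃ θ : M → A, (∀ g, ∀ h : A, θ (g * h) = θ g * h) ∧ ∀ k, ∃ g, θ (k * g) = θ g := by
  classical
  have := Fintype.ofFinite M
  have := Fintype.ofFinite (M ⧸ A)
  simp only [Nat.card_eq_fintype_card] at hmove hbig
  set a := Fintype.card A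
  set N := Fintype.card (M ⧸ A)
  have ha : (0 : ℝ) < a := by exact_mod_cast Fintype.card_pos (α := A)
  have ha1 : (1 : ℝ) ≤ a := by exact_mod_cast Fintype.card_pos (α := A)
  set r : ℝ := ((a : ℝ) - 1) / a
  have hr : 0 ≤ r := div_nonneg (by linarith) ha.le
  have hr1 : r ≤ 1 := (div_le_one ha).2 (by linarith)
  have hout : ∀ g : M, ((g : M ⧸ A).out)⁻¹ * g ∈ A := fun g =>
    QuotientGroup.eq.1 (QuotientGroup.out_eq' (g : M ⧸ A))
  let c : M → M ⧸ A → A := fun k q => ⟨((k • q).out)⁻¹ * (k * q.out), by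
    have h := hout (k * q.out)
    have e : ((k * q.out : M) : M ⧸ A) = k • q := by
      conv_rhs => rw [← QuotientGroup.out_eq' q]
      rfl
    rwa [e] at h⟩
  -- the functions without coincidence for `k`
  let bad : M → Finset (M ⧸ A → A) := fun k => {ζ | ∀ q, ζ (k • q) * c k q ≠ ζ q}
  have hbad : ∀ k : M, k ≠ 1 → (#(bad k) : ℝ) ≤ (a : ℝ) ^ N * r ^ (N / 6) := by
    intro k hk
    obtain ⟨I, hI, hIcard⟩ := exists_disjoint_image_perm (MulAction.toPerm k : Equiv.Perm (M ⧸ A))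
    have h6 : N / 6 ≤ #I := by
      have h1 := hmove k hk
      have h2 : Fintype.card {q : M ⧸ A | k • q = q} = #{q : M ⧸ A | k • q = q} := by
        exact Fintype.card_subtype fun q : M ⧸ A => k • q = q
      have h3 : #{q : M ⧸ A | k • q = q} + #{q : M ⧸ A | k • q ≠ q} = N := by
        rw [card_filter_add_card_filter_not, card_univ]
      simp only [MulAction.toPerm_apply] at hIcard
      omega
    calc (#(bad k) : ℝ) ≤ #{ζ : M ⧸ A → A | ∀ q ∈ I, ζ (k • q) * c k q ≠ ζ q} := by
          refine Nat.cast_le.2 (card_le_card fun ζ hζ => ?_)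
          simp only [bad, mem_filter, mem_univ, true_and] at hζ ⊢
          exact fun q _ => hζ q
      _ ≤ (a : ℝ) ^ N * r ^ #I := card_filter_forall_ne_le (MulAction.toPerm k) (c k) I hI
      _ ≤ (a : ℝ) ^ N * r ^ (N / 6) :=
          mul_le_mul_of_nonneg_left (pow_le_pow_of_le_one hr hr1 h6) (by positivity)
  have hMN : (Fintype.card M : ℝ) = a * N := by
    have := A.card_eq_card_quotient_mul_card_subgroup
    simp only [Nat.card_eq_fintype_card] at this
    rw [this, Nat.cast_mul, mul_comm]
  obtain ⟨ζ, hζ⟩ : ∃ ζ : M ⧸ A → A, ζ ∉ (univ.erase (1 : M)).biUnion bad := by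
    by_contra! h
    have h1 : (a : ℝ) ^ N ≤ #((univ.erase (1 : M)).biUnion bad) := by
      rw [Finset.eq_univ_iff_forall.2 h, card_univ, Fintype.card_fun]
      push_cast; exact le_rfl
    have h2 : (#((univ.erase (1 : M)).biUnion bad) : ℝ) ≤
        ∑ k ∈ univ.erase (1 : M), (#(bad k) : ℝ) := by exact_mod_cast card_biUnion_le
    have h3 : ∑ k ∈ univ.erase (1 : M), (#(bad k) : ℝ) ≤
        ∑ k : M, (a : ℝ) ^ N * r ^ (N / 6) :=
      (sum_le_sum fun k hk => hbad k (ne_of_mem_erase hk)).trans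
        (sum_le_sum_of_subset_of_nonneg (erase_subset _ _) fun _ _ _ => by positivity)
    rw [sum_const, card_univ, nsmul_eq_mul, hMN] at h3
    have h4 : (0 : ℝ) < (a : ℝ) ^ N := by positivity
    nlinarith
  refine ⟨fun g => ζ g * ⟨_, hout g⟩, fun g h => ?_, fun k => ?_⟩
  · have e : ((g * h : M) : M ⧸ A) = g := QuotientGroup.mk_mul_of_mem g h.2
    have e2 : (⟨((g * h : M) : M ⧸ A).out⁻¹ * (g * h), hout (g * h)⟩ : A) =
        ⟨(g : M ⧸ A).out⁻¹ * g, hout g⟩ * h := by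
      ext
      simp only [Subgroup.coe_mul, e, mul_assoc]
    change ζ ((g * h : M) : M ⧸ A) * _ = _
    rw [e2, e, mul_assoc]
  · by_cases hk : k = 1
    · exact ⟨1, by rw [hk, one_mul]⟩
    · have hζk : ζ ∉ bad k := fun h =>
        hζ (mem_biUnion.2 ⟨k, mem_erase.2 ⟨hk, mem_univ _⟩, h⟩)
      simp only [bad, mem_filter, mem_univ, true_and, not_forall, not_not] at hζk
      obtain ⟨q, hq⟩ := hζk
      refine ⟨q.out, ?_⟩
      have e1 : ((q.out : M) : M ⧸ A) = q := QuotientGroup.out_eq' q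
      have e2 : ((k * q.out : M) : M ⧸ A) = k • q := by
        conv_rhs => rw [← e1]
        rfl
      have e3 : (⟨((k * q.out : M) : M ⧸ A).out⁻¹ * (k * q.out), hout (k * q.out)⟩ : A) =
          c k q := Subtype.ext (by simp only [e2, c])
      have e4 : (⟨((q.out : M) : M ⧸ A).out⁻¹ * q.out, hout q.out⟩ : A) = 1 :=
        Subtype.ext (by simp only [e1, inv_mul_cancel, Subgroup.coe_one])
      simp only [e3, e4, mul_one]
      rw [e2, hq, e1]

end Counting

/-! ### Locally finite groups with infinite conjugacy classes -/

section LocallyFiniteICC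

open scoped Pointwise

variable {G : Type*} [Group G]

theorem IsICC.not_finiteIndex_centralizer (hG : IsICC G) {b : G} (hb : b ≠ 1) :
    ¬ (Subgroup.centralizer {b}).FiniteIndex := by
  intro hfin
  refine hG b hb ?_
  have hsub : conjugatesOf b ⊆ Set.range fun q : G ⧸ Subgroup.centralizer {b} =>
      q.out * b * q.out⁻¹ := by
    intro x hx
    obtain ⟨g, rfl⟩ := isConj_iff.1 (show IsConj b x from hx)
    refine ⟨(g : G ⧸ Subgroup.centralizer {b}), ?_⟩
    have h : ((g : G ⧸ Subgroup.centralizer {b}).out)⁻¹ * g ∈ Subgroup.centralizer {b} :=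
      QuotientGroup.eq.1 (QuotientGroup.out_eq' _)
    rw [Subgroup.mem_centralizer_singleton_iff] at h
    set o := (g : G ⧸ Subgroup.centralizer {b}).out
    calc o * b * o⁻¹ = o * (b * (o⁻¹ * g)) * g⁻¹ := by group
      _ = o * ((o⁻¹ * g) * b) * g⁻¹ := by rw [h]
      _ = g * b * g⁻¹ := by group
  exact (Set.finite_range _).subset hsub

/-- In a group with infinite conjugacy classes, every finite subgroup has a conjugate that meets it
trivially, as a group is not a finite union of cosets of subgroups of infinite index. -/
theorem IsICC.exists_conj_notMem (hG : IsICC G) (A : Subgroup G) [Finite A] :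
    ∃ h : G, ∀ a ∈ A, a ≠ 1 → h⁻¹ * a * h ∉ A := by
  classical
  by_contra! hcon
  choose a haA ha1 ha using hcon
  have := Fintype.ofFinite (A × A)
  -- a witness conjugating `p.1` to `p.2`, when there is one
  let s : Finset (A × A) := {p | p.1 ≠ 1 ∧ ∃ h : G, h⁻¹ * p.1 * h = p.2}
  let g : A × A → G := fun p => if hp : ∃ h : G, h⁻¹ * p.1 * h = p.2 then hp.choose else 1
  have hcov : ⋃ p ∈ s, g p • (Subgroup.centralizer {(p.2 : G)} : Set G) = Set.univ := by
    refine Set.eq_univ_of_forall fun h => ?_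
    let p : A × A := (⟨a h, haA h⟩, ⟨_, ha h⟩)
    have hp : ∃ h : G, h⁻¹ * p.1 * h = p.2 := ⟨h, rfl⟩
    refine Set.mem_iUnion₂.2 ⟨p, ?_, ?_⟩
    · simp only [s, Finset.mem_filter, Finset.mem_univ, true_and]
      exact ⟨fun h1 => ha1 h (congrArg Subtype.val h1), hp⟩
    · rw [Set.mem_smul_set_iff_inv_smul_mem, SetLike.mem_coe,
        Subgroup.mem_centralizer_singleton_iff, smul_eq_mul]
      have hg : (g p)⁻¹ * p.1 * g p = p.2 := by
        simp only [g, dif_pos hp]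
        exact hp.choose_spec
      have hh : h⁻¹ * p.1 * h = p.2 := rfl
      calc (g p)⁻¹ * h * (p.2 : G) = (g p)⁻¹ * h * (h⁻¹ * p.1 * h) := by rw [hh]
        _ = ((g p)⁻¹ * p.1 * g p) * ((g p)⁻¹ * h) := by group
        _ = _ := by rw [hg]
  obtain ⟨p, hp, hfin⟩ := Subgroup.exists_finiteIndex_of_leftCoset_cover hcov
  simp only [s, Finset.mem_filter, Finset.mem_univ, true_and] at hp
  obtain ⟨hp1, h, hh⟩ := hp
  refine hG.not_finiteIndex_centralizer (fun h2 => hp1 (Subtype.ext ?_)) hfin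
  rw [h2] at hh
  calc (p.1 : G) = h * (h⁻¹ * p.1 * h) * h⁻¹ := by group
    _ = 1 := by rw [hh]; group

/-- If `A` has a conjugate in `M` that meets it trivially, then every non-trivial element of the
finite group `M` moves at least half of the cosets of `A`. -/
theorem two_mul_card_fixed_cosets_le {M : Type*} [Group M] [Finite M] (A : Subgroup M) (h : M)
    (hA : ∀ a ∈ A, a ≠ 1 → h⁻¹ * a * h ∉ A) (k : M) (hk : k ≠ 1) :
    2 * Nat.card {q : M ⧸ A | k • q = q} ≤ Nat.card (M ⧸ A) := by
  set t : Set (M ⧸ A) := {q | k • q = q}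
  set E : Set M := QuotientGroup.mk ⁻¹' t
  have hE : ∀ g, g ∈ E ↔ g⁻¹ * k * g ∈ A := by
    intro g
    change ((k * g : M) : M ⧸ A) = g ↔ _
    rw [eq_comm, QuotientGroup.eq, mul_assoc]
  have hdisj : ∀ g ∈ E, g * h ∉ E := by
    intro g hg hgh
    rw [hE] at hg hgh
    refine hA _ hg (fun h1 => hk ?_) ?_
    · calc k = g * (g⁻¹ * k * g) * g⁻¹ := by group
        _ = 1 := by rw [h1]; group
    · convert hgh using 1; group
  have h1 : Nat.card E ≤ Nat.card (Eᶜ : Set M) := by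
    refine Nat.card_le_card_of_injective (fun g : E => (⟨g.1 * h, hdisj g.1 g.2⟩ : (Eᶜ : Set M)))
      fun g g' hgg => Subtype.ext (mul_right_cancel (congrArg Subtype.val hgg))
  have h2 : Nat.card E + Nat.card (Eᶜ : Set M) = Nat.card M := by
    rw [Nat.card_coe_set_eq, Nat.card_coe_set_eq, Set.ncard_add_ncard_compl]
  have h3 : Nat.card E = Nat.card A * Nat.card t := QuotientGroup.card_preimage_mk A t
  have h4 := A.card_eq_card_quotient_mul_card_subgroup
  have h5 : 0 < Nat.card A := Nat.card_pos
  rw [h3] at h1 h2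
  refine Nat.le_of_mul_le_mul_left (c := Nat.card A) ?_ h5
  calc Nat.card A * (2 * Nat.card t) = Nat.card A * Nat.card t + Nat.card A * Nat.card t := by ring
    _ ≤ _ := Nat.add_le_add_left h1 _
    _ = Nat.card A * Nat.card (M ⧸ A) := by rw [h2, h4, mul_comm]

/-- The conclusion of `exists_equivariant_coincidence` for large members `M` of an exhaustion by
finite subgroups. The map is normalized to be trivial at `1`. -/
theorem IsICC.exists_equivariant_coincidence [Nontrivial G] (hG : IsICC G) {L : ℕ → Subgroup G}
    (hL : Monotone L) [∀ i, Finite (L i)] (hLG : ∀ g, ∃ i, g ∈ L i) (i : ℕ) :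
    ∃ j, i < j ∧ ∃ π : G → G, π 1 = 1 ∧ (∀ g ∈ L j, π g ∈ L i) ∧
      (∀ g ∈ L j, ∀ h ∈ L i, π (g * h) = π g * h) ∧ ∀ k ∈ L j, ∃ g ∈ L j, π (k * g) = π g := by
  classical
  obtain ⟨h, hh⟩ := hG.exists_conj_notMem (L i)
  obtain ⟨i₁, hi₁⟩ := hLG h
  set a := Nat.card (L i) with ha
  have ha0 : 0 < a := Nat.card_pos
  have ha1 : (1 : ℝ) ≤ a := by exact_mod_cast ha0
  obtain ⟨n₀, hn₀⟩ := exists_forall_mul_pow_lt_one (a := a) (r := ((a : ℝ) - 1) / a)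
    (div_nonneg (by linarith) (by linarith)) ((div_lt_one (by linarith)).2 (by linarith))
  -- a member of the exhaustion with more than `a n₀` elements
  obtain ⟨i₂, hi₂⟩ : ∃ i₂, a * n₀ ≤ Nat.card (L i₂) := by
    obtain ⟨x, hx⟩ := exists_ne (1 : G)
    have : Infinite G := by
      by_contra hf
      rw [not_infinite_iff_finite] at hf
      exact hG x hx (Set.toFinite _)
    obtain ⟨s, hs⟩ := Infinite.exists_subset_card_eq G (a * n₀)
    choose m hm using hLG
    refine ⟨s.sup m, ?_⟩
    rw [← hs, ← Nat.card_eq_finsetCard]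
    refine Nat.card_le_card_of_injective
      (fun g : s => (⟨g.1, hL (Finset.le_sup g.2) (hm g.1)⟩ : L (s.sup m)))
      fun g g' hgg => Subtype.ext (Subtype.mk.inj hgg)
  set j := max (i + 1) (max i₁ i₂)
  have hij' : i < j := Nat.lt_of_succ_le (le_max_left _ _)
  have hij : i ≤ j := hij'.le
  have hhj : h ∈ L j := hL ((le_max_left _ _).trans (le_max_right _ _)) hi₁
  have hcard : a * n₀ ≤ Nat.card (L j) := hi₂.trans
    (Nat.card_le_card_of_injective _ (Subgroup.inclusion_injective
      (hL ((le_max_right i₁ i₂).trans (le_max_right (i + 1) _)))))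
  set A := (L i).subgroupOf (L j)
  have hA : Nat.card A = a := Nat.card_congr (Subgroup.subgroupOfEquivOfLe (hL hij)).toEquiv
  have hN : n₀ ≤ Nat.card (L j ⧸ A) := by
    have := A.card_eq_card_quotient_mul_card_subgroup
    rw [this, hA, mul_comm] at hcard
    exact Nat.le_of_mul_le_mul_right hcard ha0
  obtain ⟨θ, hθ, hθ'⟩ := _root_.exists_equivariant_coincidence A
    (two_mul_card_fixed_cosets_le A ⟨h, hhj⟩ fun x hx hx1 hx2 =>
      hh x.1 hx (fun h1 => hx1 (Subtype.ext h1)) hx2)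
    (by rw [hA]; exact hn₀ _ hN)
  refine ⟨j, hij', fun g => if hg : g ∈ L j then ((θ 1)⁻¹ * θ ⟨g, hg⟩ : A).1.1 else 1,
    ?_, ?_, ?_, ?_⟩
  · simp only [dif_pos (L j).one_mem]
    change ((θ 1)⁻¹ * θ 1 : A).1.1 = 1
    simp
  · intro g hg
    simp only [dif_pos hg]
    exact ((θ 1)⁻¹ * θ ⟨g, hg⟩ : A).2
  · intro g hg x hx
    have hxj := hL hij hx
    simp only [dif_pos hg, dif_pos ((L j).mul_mem hg hxj)]
    have := hθ ⟨g, hg⟩ ⟨⟨x, hxj⟩, hx⟩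
    change θ ⟨g * x, _⟩ = _ at this
    rw [this, ← mul_assoc]
    rfl
  · intro k hk
    obtain ⟨g, hg⟩ := hθ' ⟨k, hk⟩
    refine ⟨g.1, g.2, ?_⟩
    simp only [dif_pos g.2, dif_pos ((L j).mul_mem hk g.2)]
    change ((θ 1)⁻¹ * θ (⟨k, hk⟩ * g) : A).1.1 = _
    rw [hg]

end LocallyFiniteICC

/-! ### Proximal flows of locally finite groups -/

section TowerFlow

open Set

/-- An exhaustion of a group by finite subgroups `L i`, with maps `π i : L (i + 1) → L i` that are
right `L i`-equivariant and have, for all `k`, a coincidence `π i (k g) = π i g`. The maps are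
represented by maps of `G` whose values outside `L (i + 1)` are irrelevant. -/
structure CoincidenceTower (G : Type*) [Group G] where
  /-- The finite subgroups. -/
  L : ℕ → Subgroup G
  /-- The equivariant maps. -/
  π : ℕ → G → G
  mono : Monotone L
  finite : ∀ i, Finite (L i)
  exhaust : ∀ g, ∃ i, g ∈ L i
  map_one : ∀ i, π i 1 = 1
  map_mem : ∀ i, ∀ g ∈ L (i + 1), π i g ∈ L i
  map_mul : ∀ i, ∀ g ∈ L (i + 1), ∀ h ∈ L i, π i (g * h) = π i g * h
  coincidence : ∀ i, ∀ k ∈ L (i + 1), ∃ g ∈ L (i + 1), π i (k * g) = π i g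

namespace CoincidenceTower

variable {G : Type*} [Group G] (t : CoincidenceTower G)

/-- The composite `π i ∘ π (i + 1) ∘ ⋯ ∘ π (i + n - 1)`. -/
def iter : ℕ → ℕ → G → G
  | _, 0, g => g
  | i, n + 1, g => t.π i (iter (i + 1) n g)

theorem iter_mem (n : ℕ) : ∀ i, ∀ g ∈ t.L (i + n), t.iter i n g ∈ t.L i := by
  induction n with
  | zero => exact fun i g hg => hg
  | succ n ih =>
    exact fun i g hg => t.map_mem i _ (ih (i + 1) g (by rwa [Nat.succ_add_eq_add_succ]))

theorem iter_mul (n : ℕ) : ∀ i, ∀ g ∈ t.L (i + n), ∀ h ∈ t.L i,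
    t.iter i n (g * h) = t.iter i n g * h := by
  induction n with
  | zero => exact fun i g _ h _ => rfl
  | succ n ih =>
    intro i g hg h hh
    have hg' : g ∈ t.L (i + 1 + n) := by rwa [Nat.succ_add_eq_add_succ]
    simp only [iter]
    rw [ih (i + 1) g hg' h (t.mono i.le_succ hh), t.map_mul i _ (t.iter_mem n _ g hg') h hh]

/-- The composites stabilize, as `π i` is the identity on `L i`. -/
theorem iter_succ_eq (n : ℕ) : ∀ i, ∀ g ∈ t.L (i + n), t.iter i (n + 1) g = t.iter i n g := by
  induction n with
  | zero =>
    intro i g hg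
    have := t.map_mul i 1 (one_mem _) g hg
    simpa [iter, t.map_one] using this
  | succ n ih =>
    intro i g hg
    change t.π i (t.iter (i + 1) (n + 1) g) = t.π i (t.iter (i + 1) n g)
    rw [ih (i + 1) g (by rwa [Nat.succ_add_eq_add_succ])]

theorem iter_add_eq (n k : ℕ) (i : ℕ) (g : G) (hg : g ∈ t.L (i + n)) :
    t.iter i (n + k) g = t.iter i n g := by
  induction k with
  | zero => rfl
  | succ k ih => rw [← ih, ← Nat.add_assoc, t.iter_succ_eq _ _ _ (t.mono (by omega) hg)]

open Classical in
/-- The retraction of `G` onto `L i`, the limit of the composites `iter i n`. -/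
noncomputable def retract (i : ℕ) (g : G) : G :=
  t.iter i (Nat.find (t.exhaust g)) g

theorem retract_eq_iter {i n : ℕ} {g : G} (hg : g ∈ t.L (i + n)) :
    t.retract i g = t.iter i n g := by
  classical
  have h := Nat.find_spec (t.exhaust g)
  have h' : g ∈ t.L (i + Nat.find (t.exhaust g)) := t.mono (Nat.le_add_left _ _) h
  rw [retract, ← t.iter_add_eq _ n i g h', Nat.add_comm, t.iter_add_eq n _ i g hg]

theorem exists_mem_add (i : ℕ) (g : G) : ∃ n, g ∈ t.L (i + n) :=
  (t.exhaust g).imp fun _ h => t.mono (Nat.le_add_left _ _) h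

theorem retract_mem (i : ℕ) (g : G) : t.retract i g ∈ t.L i := by
  obtain ⟨n, hn⟩ := t.exists_mem_add i g
  rw [t.retract_eq_iter hn]
  exact t.iter_mem n i g hn

theorem retract_mul (i : ℕ) (g h : G) (hh : h ∈ t.L i) :
    t.retract i (g * h) = t.retract i g * h := by
  obtain ⟨n, hn⟩ := t.exists_mem_add i g
  have hm := (t.L (i + n)).mul_mem hn (t.mono (Nat.le_add_right i n) hh)
  rw [t.retract_eq_iter hm, t.retract_eq_iter hn, t.iter_mul n i g hn h hh]

theorem map_retract (i : ℕ) (g : G) : t.π i (t.retract (i + 1) g) = t.retract i g := by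
  obtain ⟨n, hn⟩ := t.exists_mem_add (i + 1) g
  have hn' : g ∈ t.L (i + (n + 1)) := by rwa [← Nat.succ_add_eq_add_succ]
  rw [t.retract_eq_iter hn, t.retract_eq_iter hn']
  rfl

/-- The flow of a tower: the sequences of right `L i`-equivariant maps `x i : G → L i` that are
compatible with the maps of the tower. -/
def flow : Set (∀ i, G → t.L i) :=
  {x | (∀ i g, ∀ h : t.L i, x i (g * h) = x i g * h) ∧ ∀ i g, t.π i (x (i + 1) g) = x i g}

namespace flow

variable {t}

instance : MulAction G t.flow where
  smul k x := ⟨fun i g => x.1 i (k⁻¹ * g), fun i g h => by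
    change x.1 i (k⁻¹ * (g * h)) = x.1 i (k⁻¹ * g) * h
    rw [← mul_assoc, x.2.1], fun i g => x.2.2 i _⟩
  one_smul x := Subtype.ext (funext fun i => funext fun g => by
    change x.1 i (1⁻¹ * g) = _; simp)
  mul_smul k l x := Subtype.ext (funext fun i => funext fun g => by
    change x.1 i ((k * l)⁻¹ * g) = x.1 i (l⁻¹ * (k⁻¹ * g)); rw [mul_inv_rev, mul_assoc])

theorem smul_apply (k : G) (x : t.flow) (i : ℕ) (g : G) : (k • x).1 i g = x.1 i (k⁻¹ * g) :=
  rfl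

instance : Nonempty t.flow :=
  ⟨⟨fun i g => ⟨t.retract i g, t.retract_mem i g⟩,
    fun i g h => Subtype.ext (t.retract_mul i g h h.2), fun i g => t.map_retract i g⟩⟩

theorem apply_eq_of_le {x y : t.flow} {i j : ℕ} (hj : j ≤ i) {g : G} (h : x.1 i g = y.1 i g) :
    x.1 j g = y.1 j g := by
  induction i, hj using Nat.le_induction with
  | base => exact h
  | succ i _ ih => exact ih (Subtype.ext (by rw [← x.2.2, ← y.2.2, h]))

/-- Any two points agree on `L i` in the coordinates up to `i` after a translation: if `x` and `y`
take the values `a` and `b` at `1` in the coordinate `i + 1`, then a coincidence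
`π i (a k) = π i (b k)` propagates to all lower coordinates. -/
theorem exists_smul_apply_eq (x y : t.flow) (i : ℕ) :
    ∃ k : G, ∀ j ≤ i, ∀ h ∈ t.L i, (k • x).1 j h = (k • y).1 j h := by
  set a := x.1 (i + 1) 1 with ha
  set b := y.1 (i + 1) 1 with hb
  obtain ⟨g, hg, hgc⟩ := t.coincidence i (a * b⁻¹ : t.L (i + 1)) (a * b⁻¹ : t.L (i + 1)).2
  set k : t.L (i + 1) := b⁻¹ * ⟨g, hg⟩ with hk
  have hx : x.1 (i + 1) k = a * k := by
    rw [ha, ← x.2.1 (i + 1) 1 k, one_mul]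
  have hy : y.1 (i + 1) k = b * k := by
    rw [hb, ← y.2.1 (i + 1) 1 k, one_mul]
  have hi : x.1 i k = y.1 i k := by
    apply Subtype.ext
    rw [← x.2.2, ← y.2.2, hx, hy, hk, mul_inv_cancel_left, ← mul_assoc]
    exact hgc
  refine ⟨(k : G)⁻¹, fun j hj h hh => ?_⟩
  simp only [smul_apply, inv_inv]
  refine apply_eq_of_le hj ?_
  rw [x.2.1 i k ⟨h, hh⟩, y.2.1 i k ⟨h, hh⟩, hi]

theorem not_forall_smul_eq (h0 : t.L 0 ≠ ⊥) (x : t.flow) : ¬ ∀ g : G, g • x = x := by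
  intro hx
  refine h0 ((Subgroup.eq_bot_iff_forall _).2 fun g hg => ?_)
  have h1 : (g⁻¹ • x).1 0 1 = x.1 0 1 * ⟨g, hg⟩ := by
    rw [smul_apply, inv_inv, mul_one, ← x.2.1 0 1 ⟨g, hg⟩, one_mul]
  rw [hx, left_eq_mul] at h1
  exact congrArg Subtype.val h1

variable [TopologicalSpace G]

theorem continuous_apply (i : ℕ) (g : G) : Continuous fun x : t.flow => x.1 i g :=
  (_root_.continuous_apply g).comp ((_root_.continuous_apply i).comp continuous_subtype_val)

variable [DiscreteTopology G]

instance : CompactSpace t.flow := by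
  have := t.finite
  have hc : ∀ i g, Continuous fun x : ∀ i, G → t.L i => x i g := fun i g => by fun_prop
  have hcl : IsClosed t.flow := by
    simp only [flow, ofPred_and, ofPred_forall]
    refine (isClosed_iInter fun i => isClosed_iInter fun g => isClosed_iInter fun h => ?_).inter
      (isClosed_iInter fun i => isClosed_iInter fun g => ?_)
    · exact isClosed_eq (hc i _)
        ((continuous_of_discreteTopology (f := fun a : t.L i => a * h)).comp (hc i g))
    · exact isClosed_eq
        ((continuous_of_discreteTopology (f := fun a : t.L (i + 1) => t.π i a)).comp (hc _ g))
        (continuous_subtype_val.comp (hc i g))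
  exact isCompact_iff_compactSpace.1 hcl.isCompact

instance : ContinuousSMul G t.flow := by
  refine ⟨continuous_prod_of_discrete_left.2 fun k => ?_⟩
  exact continuous_induced_rng.2 (continuous_pi fun i => continuous_pi fun g =>
    continuous_apply i (k⁻¹ * g))

theorem isProximalAction : IsProximalAction G t.flow := by
  rintro ⟨x, y⟩
  have hcl : ∀ i : ℕ, IsClosed (closure (MulAction.orbit G (x, y)) ∩
      {p : t.flow × t.flow | ∀ j ≤ i, ∀ h ∈ t.L i, p.1.1 j h = p.2.1 j h}) := by
    intro i
    simp only [ofPred_forall]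
    exact isClosed_closure.inter (isClosed_iInter fun j => isClosed_iInter fun _ =>
      isClosed_iInter fun h => isClosed_iInter fun _ => isClosed_eq
        ((continuous_apply j h).comp continuous_fst) ((continuous_apply j h).comp continuous_snd))
  obtain ⟨⟨z, z'⟩, hz⟩ := IsCompact.nonempty_iInter_of_sequence_nonempty_isCompact_isClosed
    (fun i : ℕ => closure (MulAction.orbit G (x, y)) ∩
      {p : t.flow × t.flow | ∀ j ≤ i, ∀ h ∈ t.L i, p.1.1 j h = p.2.1 j h})
    (fun i => inter_subset_inter_right _ fun p hp j hj h hh =>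
      hp j (hj.trans i.le_succ) h (t.mono i.le_succ hh))
    (fun i => (exists_smul_apply_eq x y i).elim fun k hk =>
      ⟨k • (x, y), subset_closure ⟨k, rfl⟩, hk⟩)
    (hcl 0).isCompact hcl
  rw [mem_iInter] at hz
  refine ⟨(z, z'), (hz 0).1, Subtype.ext (funext fun i => funext fun g => ?_)⟩
  obtain ⟨m, hm⟩ := t.exists_mem_add i g
  exact (hz (i + m)).2 i (Nat.le_add_right _ _) g hm

end flow

end CoincidenceTower

/-- A non-trivial group with infinite conjugacy classes and an exhaustion by finite subgroups has a
tower with coincidences. -/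
theorem IsICC.exists_coincidenceTower {G : Type*} [Group G] [Nontrivial G] (hG : IsICC G)
    {L : ℕ → Subgroup G} (hL : Monotone L) (hfin : ∀ i, Finite (L i))
    (hLG : ∀ g, ∃ i, g ∈ L i) : ∃ t : CoincidenceTower G, t.L 0 ≠ ⊥ := by
  choose j hj π h1 hmem hmul hco using fun i => hG.exists_equivariant_coincidence hL hLG i
  obtain ⟨x, hx⟩ := exists_ne (1 : G)
  obtain ⟨i₀, hi₀⟩ := hLG x
  let m : ℕ → ℕ := fun k => j^[k] i₀
  have hm : ∀ k, m (k + 1) = j (m k) := fun k => Function.iterate_succ_apply' j k i₀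
  have hms : StrictMono m := strictMono_nat_of_lt_succ fun k => by rw [hm]; exact hj _
  refine ⟨
    { L := fun k => L (m k)
      π := fun k => π (m k)
      mono := hL.comp hms.monotone
      finite := fun k => hfin _
      exhaust := fun g => (hLG g).imp fun i hi => hL (hms.le_apply) hi
      map_one := fun k => h1 _
      map_mem := fun k => by rw [hm]; exact hmem _
      map_mul := fun k => by rw [hm]; exact hmul _
      coincidence := fun k => by rw [hm]; exact hco _ }, fun h => hx ?_⟩
  exact (Subgroup.eq_bot_iff_forall _).1 h x hi₀

theorem StronglyAmenable.of_mulEquiv {G : Type v} {G' : Type w} [Group G] [Group G']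
    [TopologicalSpace G] [TopologicalSpace G'] (e : G ≃* G')
    (he : Continuous e) (h : StronglyAmenable.{u} G) : StronglyAmenable.{u} G' := by
  intro X _ _ _ _ _ _ hX
  let _ : MulAction G X := MulAction.compHom X e.toMonoidHom
  have hs : ∀ (g : G) (x : X), g • x = e g • x := fun _ _ => rfl
  have : ContinuousSMul G X := ⟨by
    simp only [hs]
    exact (he.comp continuous_fst).smul continuous_snd⟩
  have horb : ∀ p : X × X, MulAction.orbit G p = MulAction.orbit G' p := fun p =>
    e.surjective.range_comp fun g : G' => g • p
  obtain ⟨x, hx⟩ := h X fun p => by rw [horb]; exact hX p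
  exact ⟨x, fun g => by rw [← e.apply_symm_apply g, ← hs]; exact hx _⟩

theorem IsICC.of_mulEquiv {G G' : Type*} [Group G] [Group G'] (e : G ≃* G') (h : IsICC G) :
    IsICC G' := by
  intro g hg
  have h1 := h (e.symm g) (by simpa using hg)
  refine (h1.image e.injective.injOn).mono ?_
  rintro _ ⟨x, hx, rfl⟩
  have : IsConj (e (e.symm g)) (e x) := MonoidHom.map_isConj e.toMonoidHom hx
  rwa [e.apply_symm_apply] at this

theorem countable_of_forall_exists_mem {G : Type*} [Group G] (L : ℕ → Subgroup G)
    (hfin : ∀ i, Finite (L i)) (hLG : ∀ g, ∃ i, g ∈ L i) : Countable G := by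
  have h : (⋃ i, (L i : Set G)) = Set.univ :=
    Set.eq_univ_of_forall fun g => Set.mem_iUnion.2 (hLG g)
  rw [← Set.countable_univ_iff, ← h]
  exact Set.countable_iUnion fun i => (Set.toFinite (L i : Set G)).countable

/-- A discrete group with infinite conjugacy classes that is exhausted by a sequence of finite
subgroups is not strongly amenable. -/
theorem IsICC.not_stronglyAmenable {G : Type v} [Group G] [TopologicalSpace G] [DiscreteTopology G]
    [Nontrivial G] (hG : IsICC G) {L : ℕ → Subgroup G} (hL : Monotone L)
    (hfin : ∀ i, Finite (L i)) (hLG : ∀ g, ∃ i, g ∈ L i) : ¬ StronglyAmenable.{u} G := by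
  -- being countable, the group has a copy in the universe of the flows
  have : Countable G := countable_of_forall_exists_mem L hfin hLG
  have : Small.{u} G := inferInstance
  let e : G ≃* Shrink.{u} G := (Shrink.mulEquiv (α := G)).symm
  let _ : TopologicalSpace (Shrink.{u} G) := ⊥
  have : DiscreteTopology (Shrink.{u} G) := ⟨rfl⟩
  have : Nontrivial (Shrink.{u} G) := e.symm.toEquiv.nontrivial
  intro hSA
  have hSA' : StronglyAmenable.{u} (Shrink.{u} G) :=
    hSA.of_mulEquiv e continuous_of_discreteTopology
  obtain ⟨t, ht⟩ := (hG.of_mulEquiv e).exists_coincidenceTower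
    (L := fun i => (L i).map e.toMonoidHom) (fun i j hij => Subgroup.map_mono (hL hij))
    (fun i => ((Set.toFinite (L i : Set G)).image e).to_subtype)
    (fun g => (hLG (e.symm g)).imp fun i hi => ⟨_, hi, e.apply_symm_apply g⟩)
  obtain ⟨x, hx⟩ := hSA' t.flow CoincidenceTower.flow.isProximalAction
  exact CoincidenceTower.flow.not_forall_smul_eq ht x hx

end TowerFlow

/-! ### Rooted coloured trees -/

section RootedTree

variable {V Ω : Type*} {T : SimpleGraph V} {c : T.EdgeLabeling Ω} (hc : IsLegalColoring c)

/-- The neighbour of `v` along the edge of colour `a`. -/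
noncomputable def nb (v : V) (a : Ω) : V :=
  ((starEquiv hc v).symm a).1

theorem adj_nb (v : V) (a : Ω) : T.Adj v (nb hc v a) :=
  ((starEquiv hc v).symm a).2

theorem get_nb (v : V) (a : Ω) : c.get v (nb hc v a) (adj_nb hc v a) = a :=
  (starEquiv hc v).apply_symm_apply a

theorem nb_get {v w : V} (h : T.Adj v w) : nb hc v (c.get v w h) = w :=
  congrArg Subtype.val ((starEquiv hc v).symm_apply_apply ⟨w, h⟩)

theorem nb_injective (v : V) : Function.Injective (nb hc v) :=
  Subtype.val_injective.comp (starEquiv hc v).symm.injective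

theorem adj_iff_exists_nb {v w : V} : T.Adj v w ↔ ∃ a, nb hc v a = w :=
  ⟨fun h => ⟨_, nb_get hc h⟩, by rintro ⟨a, rfl⟩; exact adj_nb hc v a⟩

@[simp]
theorem nb_nb (v : V) (a : Ω) : nb hc (nb hc v a) a = v := by
  have h := nb_get hc (adj_nb hc v a).symm
  rwa [SimpleGraph.EdgeLabeling.get_comm, get_nb] at h

theorem apply_nb (g : T ≃g T) (v : V) (a : Ω) :
    g (nb hc v a) = nb hc (g v) (localPerm hc g v a) := by
  simp only [nb, localPerm, Equiv.trans_apply, Equiv.symm_apply_apply]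
  rfl

theorem localPerm_eq_of_apply_nb {g : T ≃g T} {v : V} {s : Equiv.Perm Ω}
    (h : ∀ a, g (nb hc v a) = nb hc (g v) (s a)) : localPerm hc g v = s :=
  Equiv.ext fun a => nb_injective hc (g v) (by rw [← apply_nb, h])

/-- The local permutations at the two ends of an edge agree on its colour. -/
theorem localPerm_nb (g : T ≃g T) (v : V) (a : Ω) :
    localPerm hc g (nb hc v a) a = localPerm hc g v a := by
  apply nb_injective hc (g (nb hc v a))
  rw [← apply_nb, nb_nb, apply_nb, nb_nb]

variable (hT : T.IsTree) (v₀ : V)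

/-- The edge of colour `a` at `v` leads away from the root `v₀`. -/
def IsChild (v : V) (a : Ω) : Prop :=
  T.dist v₀ (nb hc v a) = T.dist v₀ v + 1

include hT

theorem isChild_or (v : V) (a : Ω) : IsChild hc v₀ v a ∨ IsChild hc v₀ (nb hc v a) a := by
  rcases hT.dist_eq_dist_add_one_of_adj v₀ (adj_nb hc v a) with h | h
  · right
    rw [IsChild, nb_nb, h]
  · exact Or.inl h

theorem dist_nb_of_not_isChild {v : V} {a : Ω} (h : ¬ IsChild hc v₀ v a) :
    T.dist v₀ v = T.dist v₀ (nb hc v a) + 1 := by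
  have := (isChild_or hc hT v₀ v a).resolve_left h
  rwa [IsChild, nb_nb] at this

/-- At most one edge at a vertex leads to the root, as the path to the root is unique. -/
theorem eq_of_not_isChild {v : V} {a b : Ω} (ha : ¬ IsChild hc v₀ v a)
    (hb : ¬ IsChild hc v₀ v b) : a = b := by
  have key : ∀ x, ¬ IsChild hc v₀ v x → ∃ p : T.Walk v₀ (nb hc v x),
      (p.concat (adj_nb hc v x).symm).IsPath := by
    intro x hx
    obtain ⟨p, hp⟩ := hT.connected.exists_walk_length_eq_dist v₀ (nb hc v x)
    refine ⟨p, SimpleGraph.Walk.isPath_of_length_eq_dist _ ?_⟩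
    rw [SimpleGraph.Walk.length_concat, hp, dist_nb_of_not_isChild hc hT v₀ hx]
  obtain ⟨p, hp⟩ := key a ha
  obtain ⟨q, hq⟩ := key b hb
  have h := congrArg Subtype.val ((hT.isAcyclic.subsingleton_path v₀ v).elim
    ⟨_, hp⟩ ⟨_, hq⟩)
  have h2 := congrArg SimpleGraph.Walk.penultimate h
  simp only [SimpleGraph.Walk.penultimate_concat] at h2
  exact nb_injective hc v h2

theorem exists_not_isChild {v : V} (hv : v ≠ v₀) : ∃ a, ¬ IsChild hc v₀ v a := by
  obtain ⟨p, hp⟩ := hT.connected.exists_walk_length_eq_dist v v₀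
  cases p with
  | nil => exact absurd rfl hv
  | @cons _ w _ h p =>
    refine ⟨c.get v w h, fun hch => ?_⟩
    rw [IsChild, nb_get, SimpleGraph.dist_comm, SimpleGraph.dist_comm (u := v₀), ← hp,
      SimpleGraph.Walk.length_cons] at hch
    have := SimpleGraph.dist_le p
    omega

theorem isChild_root (a : Ω) : IsChild hc v₀ v₀ a := by
  by_contra h
  have := dist_nb_of_not_isChild hc hT v₀ h
  rw [SimpleGraph.dist_self] at this
  omega

omit hT in
theorem not_isChild_nb {v : V} {a : Ω} (h : IsChild hc v₀ v a) :
    ¬ IsChild hc v₀ (nb hc v a) a := by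
  rw [IsChild] at h ⊢
  rw [nb_nb]
  omega

/-- Induction on the distance to the root. -/
theorem rooted_induction {P : V → Prop} (h0 : P v₀)
    (hs : ∀ v a, IsChild hc v₀ v a → P v → P (nb hc v a)) (v : V) : P v := by
  induction hn : T.dist v₀ v generalizing v with
  | zero =>
    rwa [← (hT.connected.dist_eq_zero_iff).1 hn]
  | succ n ih =>
    have hv : v ≠ v₀ := by
      rintro rfl
      rw [SimpleGraph.dist_self] at hn
      omega
    obtain ⟨a, ha⟩ := exists_not_isChild hc hT v₀ hv
    have h1 := dist_nb_of_not_isChild hc hT v₀ ha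
    have h2 := hs (nb hc v a) a ((isChild_or hc hT v₀ v a).resolve_left ha) (ih _ (by omega))
    rwa [nb_nb] at h2

/-- Recursion along the tree: a function can be defined by choosing its value at a vertex in terms
of the value at the neighbour closer to the root. -/
theorem exists_rooted_recursion {α : Type*} (P : V → α → Prop) (R : V → Ω → α → α → Prop) (x₀ : α)
    (h0 : P v₀ x₀)
    (hs : ∀ v a x, IsChild hc v₀ v a → P v x → ∃ y, P (nb hc v a) y ∧ R v a x y) :
    ∃ s : V → α, s v₀ = x₀ ∧ (∀ v, P v (s v)) ∧
      ∀ v a, IsChild hc v₀ v a → R v a (s v) (s (nb hc v a)) := by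
  classical
  choose! f hf using hs
  by_cases hΩ : Nonempty Ω
  swap
  · refine ⟨fun _ => x₀, rfl, fun v => ?_, fun v a => (hΩ ⟨a⟩).elim⟩
    exact rooted_induction hc hT v₀ (P := fun v => P v x₀) h0 (fun v a => (hΩ ⟨a⟩).elim) v
  choose! p hp using fun v (hv : v ≠ v₀) => exists_not_isChild hc hT v₀ hv
  let S : ℕ → V → α := fun n => Nat.rec (fun _ => x₀)
    (fun _ S v => f (nb hc v (p v)) (p v) (S (nb hc v (p v)))) n
  let s : V → α := fun v => S (T.dist v₀ v) v
  have hs0 : s v₀ = x₀ := by simp [s, S]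
  have hsc : ∀ v a, IsChild hc v₀ v a → s (nb hc v a) = f v a (s v) := by
    intro v a h
    have hne : nb hc v a ≠ v₀ := by
      intro h2
      rw [IsChild, h2, SimpleGraph.dist_self] at h
      omega
    have hpa : p (nb hc v a) = a :=
      eq_of_not_isChild hc hT v₀ (hp _ hne) (not_isChild_nb hc v₀ h)
    have : s (nb hc v a) = S (T.dist v₀ v + 1) (nb hc v a) := by simp only [s]; rw [h]
    rw [this]
    change f (nb hc (nb hc v a) (p (nb hc v a))) (p (nb hc v a))
      (S (T.dist v₀ v) (nb hc (nb hc v a) (p (nb hc v a)))) = _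
    rw [hpa, nb_nb]
  have hP : ∀ v, P v (s v) := rooted_induction hc hT v₀ (by rwa [hs0]) fun v a h hv => by
    rw [hsc v a h]
    exact (hf v a (s v) h hv).1
  exact ⟨s, hs0, hP, fun v a h => by rw [hsc v a h]; exact (hf v a (s v) h (hP v)).2⟩

/-- Local permutations that agree on the colour of every edge are those of an automorphism fixing
the root. -/
theorem exists_localPerm_eq (s : V → Equiv.Perm Ω)
    (hs : ∀ v a, IsChild hc v₀ v a → s (nb hc v a) a = s v a) :
    ∃ g : T ≃g T, g v₀ = v₀ ∧ ∀ v, localPerm hc g v = s v := by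
  have hs' : ∀ v a, s (nb hc v a) a = s v a := by
    intro v a
    rcases isChild_or hc hT v₀ v a with h | h
    · exact hs v a h
    · have := hs _ a h
      rw [nb_nb] at this
      exact this.symm
  obtain ⟨h, h0, -, hR⟩ := exists_rooted_recursion hc hT v₀ (fun _ _ => True)
    (fun v a x y => y = nb hc x (s v a)) v₀ trivial fun v a x _ _ => ⟨_, trivial, rfl⟩
  have hnb : ∀ v a, h (nb hc v a) = nb hc (h v) (s v a) := by
    intro v a
    rcases isChild_or hc hT v₀ v a with hch | hch
    · exact hR v a hch
    · have := hR _ a hch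
      rw [nb_nb, hs'] at this
      rw [this, nb_nb]
  -- the map preserves the distance to the root, and the edge leading to the root
  have hlev : ∀ v, T.dist v₀ (h v) = T.dist v₀ v ∧
      ∀ a, IsChild hc v₀ v a → IsChild hc v₀ (h v) (s v a) := by
    refine rooted_induction hc hT v₀ ⟨by rw [h0], fun a _ => ?_⟩ fun v a hch ⟨ih1, ih2⟩ => ?_
    · rw [h0]; exact isChild_root hc hT v₀ _
    · have hch' := ih2 a hch
      refine ⟨by rw [hnb, hch', hch, ih1], fun b hb => ?_⟩
      by_contra hcon
      rw [hnb] at hcon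
      have hab := eq_of_not_isChild hc hT v₀ hcon (not_isChild_nb hc v₀ hch')
      rw [← hs' v a] at hab
      rw [(s (nb hc v a)).injective hab] at hb
      exact not_isChild_nb hc v₀ hch hb
  have hinj : ∀ v w, h v = h w → v = w := by
    refine rooted_induction hc hT v₀ (fun w hw => ?_) fun v a hch ih w hw => ?_
    · have := (hlev w).1
      rw [← hw, h0, SimpleGraph.dist_self] at this
      exact (hT.connected.dist_eq_zero_iff).1 this.symm
    · have hw0 : w ≠ v₀ := by
        rintro rfl
        have := (hlev (nb hc v a)).1
        rw [hw, h0, SimpleGraph.dist_self, hch] at this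
        omega
      obtain ⟨b, hb⟩ := exists_not_isChild hc hT v₀ hw0
      have hbc := (isChild_or hc hT v₀ w b).resolve_left hb
      have e : h w = nb hc (h (nb hc w b)) (s (nb hc w b) b) := by rw [← hnb, nb_nb]
      have h1 := not_isChild_nb hc v₀ ((hlev v).2 a hch)
      have h2 := not_isChild_nb hc v₀ ((hlev _).2 b hbc)
      rw [← e, ← hw] at h2
      rw [← hnb] at h1
      have hab := eq_of_not_isChild hc hT v₀ h1 h2
      have hvw : h v = h (nb hc w b) := by
        rw [← nb_nb hc (h v) (s v a), ← hnb, hw, e, hab, nb_nb]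
      have hv := ih _ hvw
      subst hv
      rw [(s (nb hc w b)).injective hab, nb_nb]
  have hsurj : Function.Surjective h := by
    refine rooted_induction hc hT v₀ ⟨v₀, h0⟩ ?_
    rintro _ a _ ⟨v, rfl⟩
    exact ⟨nb hc v ((s v).symm a), by rw [hnb, Equiv.apply_symm_apply]⟩
  refine ⟨⟨Equiv.ofBijective h ⟨fun v w => hinj v w, hsurj⟩, fun {v w} => ?_⟩, h0, fun v => ?_⟩
  · change T.Adj (h v) (h w) ↔ T.Adj v w
    rw [adj_iff_exists_nb hc, adj_iff_exists_nb hc]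
    constructor
    · rintro ⟨a, ha⟩
      exact ⟨(s v).symm a, hinj _ _ (by rw [hnb, Equiv.apply_symm_apply, ha])⟩
    · rintro ⟨a, rfl⟩
      exact ⟨s v a, (hnb v a).symm⟩
  · exact localPerm_eq_of_apply_nb hc fun a => hnb v a

include hc in
theorem finite_dist_le [Finite Ω] (m : ℕ) : {v | T.dist v₀ v ≤ m}.Finite := by
  induction m with
  | zero =>
    refine (Set.finite_singleton v₀).subset fun v hv => ?_
    exact ((hT.connected.dist_eq_zero_iff).1 (Nat.le_zero.1 hv)).symm
  | succ m ih =>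
    refine ((Set.finite_singleton v₀).union
      ((ih.prod (Set.finite_univ (α := Ω))).image fun p => nb hc p.1 p.2)).subset fun v hv => ?_
    by_cases h : v = v₀
    · exact Or.inl h
    · obtain ⟨a, ha⟩ := exists_not_isChild hc hT v₀ h
      have := dist_nb_of_not_isChild hc hT v₀ ha
      refine Or.inr ⟨(nb hc v a, a), ⟨?_, trivial⟩, nb_nb hc v a⟩
      have hv : T.dist v₀ v ≤ m + 1 := hv
      change T.dist v₀ (nb hc v a) ≤ m
      omega

omit hT in
theorem dist_apply_le (hT : T.Connected) (g : T ≃g T) (v w : V) :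
    T.dist (g v) (g w) ≤ T.dist v w := by
  obtain ⟨p, hp⟩ := hT.exists_walk_length_eq_dist v w
  rw [← hp, ← SimpleGraph.Walk.length_map (g : T →g T) p]
  exact SimpleGraph.dist_le _

variable {v₀}

theorem dist_apply_of_fixed {g : T ≃g T} (hg : g v₀ = v₀) (v : V) :
    T.dist v₀ (g v) = T.dist v₀ v := by
  refine le_antisymm ?_ ?_
  · have := dist_apply_le hT.connected g v₀ v
    rwa [hg] at this
  · have := dist_apply_le hT.connected g⁻¹ (g v₀) (g v)
    rwa [hg, ← hg, RelIso.inv_apply_self, RelIso.inv_apply_self, hg] at this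

theorem isChild_apply_iff {g : T ≃g T} (hg : g v₀ = v₀) (v : V) (a : Ω) :
    IsChild hc v₀ (g v) (localPerm hc g v a) ↔ IsChild hc v₀ v a := by
  rw [IsChild, IsChild, ← apply_nb, dist_apply_of_fixed hT hg, dist_apply_of_fixed hT hg]

end RootedTree

/-! ### The topology of the automorphism group of a tree -/

section AutTopology

open Set

variable {V : Type*} {T : SimpleGraph V}

theorem isOpen_setOf_aut_apply_eq (v w : V) : IsOpen {g : T ≃g T | g v = w} := by
  let _ : TopologicalSpace V := ⊥
  have : DiscreteTopology V := ⟨rfl⟩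
  have h : Continuous fun g : T ≃g T => g v :=
    (continuous_apply v).comp (continuous_induced_dom (f := fun g : T ≃g T => (g : V → V)))
  exact (isOpen_discrete {w}).preimage h

theorem continuous_aut_rng {Y : Type*} [TopologicalSpace Y] {f : Y → (T ≃g T)}
    (hf : ∀ v w, IsOpen {y | f y v = w}) : Continuous f := by
  let _ : TopologicalSpace V := ⊥
  have : DiscreteTopology V := ⟨rfl⟩
  refine continuous_induced_rng.2 (continuous_pi fun v => ?_)
  exact continuous_discrete_rng.2 fun w => hf v w

instance SimpleGraph.autIsTopologicalGroup : IsTopologicalGroup (T ≃g T) where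
  continuous_mul := by
    refine continuous_aut_rng fun v w => ?_
    have : {p : (T ≃g T) × (T ≃g T) | (p.1 * p.2) v = w} =
        ⋃ u, {g : T ≃g T | g u = w} ×ˢ {g : T ≃g T | g v = u} := by
      ext p
      simp [RelIso.mul_apply]
    rw [this]
    exact isOpen_iUnion fun u =>
      (isOpen_setOf_aut_apply_eq u w).prod (isOpen_setOf_aut_apply_eq v u)
  continuous_inv := by
    refine continuous_aut_rng fun v w => ?_
    convert isOpen_setOf_aut_apply_eq (T := T) w v using 1
    ext g
    constructor
    · rintro h
      change g⁻¹ v = w at h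
      change g w = v
      rw [← h, RelIso.apply_inv_self]
    · rintro h
      change g w = v at h
      change g⁻¹ v = w
      rw [← h, RelIso.inv_apply_self]

instance SimpleGraph.autT2Space : T2Space (T ≃g T) := by
  let _ : TopologicalSpace V := ⊥
  have : DiscreteTopology V := ⟨rfl⟩
  exact T2Space.of_injective_continuous (f := fun g : T ≃g T => (g : V → V))
    DFunLike.coe_injective continuous_induced_dom

theorem isOpen_setOf_stabilizer_smul_eq (v₀ v w : V) :
    IsOpen {g : MulAction.stabilizer (T ≃g T) v₀ | g • v = w} :=
  (isOpen_setOf_aut_apply_eq v w).preimage continuous_subtype_val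

/-- The stabilizer of a vertex is compact when the balls are finite. It is a continuous image of
the closed set of pairs of mutually inverse graph maps, in a product of finite spheres. -/
theorem compactSpace_stabilizer (hT : T.IsTree) (v₀ : V)
    (hfin : ∀ m, {v | T.dist v₀ v ≤ m}.Finite) :
    CompactSpace (MulAction.stabilizer (T ≃g T) v₀) := by
  let _ : TopologicalSpace V := ⊥
  have : DiscreteTopology V := ⟨rfl⟩
  let S : Set ((V → V) × (V → V)) := {p | p.1 v₀ = v₀ ∧ ∀ v w,
    (p.1 v = w ↔ p.2 w = v) ∧ (T.Adj (p.1 v) (p.1 w) ↔ T.Adj v w)}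
  let aut : S → MulAction.stabilizer (T ≃g T) v₀ := fun p =>
    ⟨⟨⟨p.1.1, p.1.2, fun v => ((p.2.2 v _).1.1 rfl), fun w => ((p.2.2 _ w).1.2 rfl)⟩,
      fun {v w} => (p.2.2 v w).2⟩, p.2.1⟩
  have haut : ∀ (p : S) (v : V), (aut p).1 v = p.1.1 v := fun _ _ => rfl
  have hcl : IsClosed S := by
    have h : ∀ v w : V, Continuous fun p : (V → V) × (V → V) => (p.1 v, p.1 w, p.2 w) :=
      fun v w => by fun_prop
    have hS : S = {p | p.1 v₀ = v₀} ∩ ⋂ v, ⋂ w, (fun p => (p.1 v, p.1 w, p.2 w)) ⁻¹'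
        {q : V × V × V | (q.1 = w ↔ q.2.2 = v) ∧ (T.Adj q.1 q.2.1 ↔ T.Adj v w)} := by
      ext p
      simp [S]
    rw [hS]
    exact (isClosed_eq (by fun_prop) (by fun_prop)).inter
      (isClosed_iInter fun v => isClosed_iInter fun w => (isClosed_discrete _).preimage (h v w))
  have hbox : IsCompact (Set.univ.pi fun v => {w | T.dist v₀ w ≤ T.dist v₀ v}) :=
    isCompact_univ_pi fun v => (hfin _).isCompact
  have hcomp : IsCompact S := by
    refine (hbox.prod hbox).of_isClosed_subset hcl fun p hp => ⟨fun v _ => ?_, fun v _ => ?_⟩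
    · exact (dist_apply_of_fixed hT (g := (aut ⟨p, hp⟩).1) hp.1 v).le
    · have h := dist_apply_of_fixed hT (g := (aut ⟨p, hp⟩).1) hp.1 (p.2 v)
      have h2 : p.1 (p.2 v) = v := (hp.2 _ v).1.2 rfl
      change T.dist v₀ (p.1 (p.2 v)) = _ at h
      rw [h2] at h
      exact h.ge
  have := isCompact_iff_compactSpace.1 hcomp
  have hcont : Continuous aut := by
    refine continuous_induced_rng.2 (continuous_aut_rng fun v w => ?_)
    have h : Continuous fun p : S => p.1.1 v := by fun_prop
    exact (isOpen_discrete {w}).preimage h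
  have hsurj : Function.Surjective aut := by
    intro g
    refine ⟨⟨(g.1, g.1.symm), g.2, fun v w => ⟨?_, g.1.map_rel_iff⟩⟩, ?_⟩
    · exact ⟨fun h => by rw [← h]; exact g.1.symm_apply_apply v,
        fun h => by rw [← h]; exact g.1.apply_symm_apply w⟩
    · ext v
      rfl
  exact hsurj.compactSpace hcont

end AutTopology

/-! ### Automorphisms with almost prescribed local permutations -/

section Prescribed

variable {V Ω : Type*} {T : SimpleGraph V} {c : T.EdgeLabeling Ω} {hc : IsLegalColoring c}
  {v₀ : V} {F F' : Subgroup (Equiv.Perm Ω)}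

theorem IsSemiRegular.eq_one (hF : IsSemiRegular F) {σ : Equiv.Perm Ω} (hσ : σ ∈ F) {a : Ω}
    (h : σ a = a) : σ = 1 := by
  have h1 : (⟨σ, hσ⟩ : F) ∈ MulAction.stabilizer F a := h
  rw [hF a, Subgroup.mem_bot] at h1
  exact congrArg Subtype.val h1

theorem IsSemiRegular.eq_of_apply_eq (hF : IsSemiRegular F) {σ τ : Equiv.Perm Ω} (hσ : σ ∈ F)
    (hτ : τ ∈ F) {a : Ω} (h : σ a = τ a) : σ = τ := by
  refine (inv_mul_eq_one.1 (hF.eq_one (F.mul_mem (F.inv_mem hτ) hσ) (a := a) ?_)).symm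
  rw [Equiv.Perm.mul_apply, Equiv.Perm.inv_eq_iff_eq, h]

theorem apply_root_of_mem {g : T ≃g T} (hg : g ∈ vertexStabPrescribed hc F F' v₀) : g v₀ = v₀ :=
  hg.2

/-- An automorphism fixing the root whose local permutations outside of a ball are in the
semi-regular group `F` is determined by its local permutations in that ball. -/
theorem eq_of_localPerm_eq (hT : T.IsTree) (hF : IsSemiRegular F) {g h : T ≃g T} (hg : g v₀ = v₀)
    (hh : h v₀ = v₀) (m : ℕ) (hm : ∀ v, T.dist v₀ v ≤ m → localPerm hc g v = localPerm hc h v)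
    (hgF : ∀ v, m < T.dist v₀ v → localPerm hc g v ∈ F)
    (hhF : ∀ v, m < T.dist v₀ v → localPerm hc h v ∈ F) : g = h := by
  suffices H : ∀ v, g v = h v ∧ localPerm hc g v = localPerm hc h v from
    RelIso.ext fun v => (H v).1
  refine rooted_induction hc hT v₀ ⟨hg.trans hh.symm, hm _ (by simp)⟩ fun v a _ ⟨h1, h2⟩ => ?_
  refine ⟨by rw [apply_nb, apply_nb, h1, h2], ?_⟩
  rcases le_or_gt (T.dist v₀ (nb hc v a)) m with hle | hlt
  · exact hm _ hle
  · refine hF.eq_of_apply_eq (hgF _ hlt) (hhF _ hlt) (a := a) ?_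
    rw [localPerm_nb, localPerm_nb, h2]

/-- As `F` and `F'` have the same orbits, an element of `K(F, F')` can be constructed from the root
outwards with local permutations in prescribed cosets of `F`. -/
theorem exists_mem_vertexStabPrescribed (hT : T.IsTree) (hFF : F ≤ F')
    (horb : PreservesOrbits F' F) (t : V → Equiv.Perm Ω) (ht : ∀ v, t v ∈ F')
    (hfin : {v | t v ∉ F}.Finite) :
    ∃ g ∈ vertexStabPrescribed hc F F' v₀, localPerm hc g v₀ = t v₀ ∧
      ∀ v, localPerm hc g v * (t v)⁻¹ ∈ F := by
  have hstep : ∀ v a (x : Equiv.Perm Ω), IsChild hc v₀ v a → x * (t v)⁻¹ ∈ F →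
      ∃ y, y * (t (nb hc v a))⁻¹ ∈ F ∧ y a = x a := by
    intro v a x _ hx
    have hx' : x ∈ F' := by simpa using F'.mul_mem (hFF hx) (ht v)
    obtain ⟨⟨e₁, he₁⟩, h₁⟩ := horb x hx' a
    obtain ⟨⟨e₂, he₂⟩, h₂⟩ := horb (t (nb hc v a)) (ht _) a
    change e₁ a = x a at h₁
    change e₂ a = t (nb hc v a) a at h₂
    refine ⟨e₁ * e₂⁻¹ * t (nb hc v a), ?_, ?_⟩
    · simpa using F.mul_mem he₁ (F.inv_mem he₂)
    · rw [Equiv.Perm.mul_apply, Equiv.Perm.mul_apply, Equiv.Perm.inv_eq_iff_eq.2 h₂.symm, h₁]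
  obtain ⟨s, hs0, hsP, hsR⟩ := exists_rooted_recursion hc hT v₀ (fun v s => s * (t v)⁻¹ ∈ F)
    (fun _ a x y => y a = x a) (t v₀) (by simp [F.one_mem]) hstep
  obtain ⟨g, hg0, hg⟩ := exists_localPerm_eq hc hT v₀ s hsR
  refine ⟨g, ⟨⟨fun v => ?_, hfin.subset fun v hv hv' => hv ?_⟩, hg0⟩, by rw [hg, hs0],
    fun v => by rw [hg]; exact hsP v⟩
  · rw [hg]
    simpa using F'.mul_mem (hFF (hsP v)) (ht v)
  · rw [hg]
    simpa using F.mul_mem (hsP v) hv'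

theorem exists_mem_ne_one_apply_eq (hFF : F < F') (horb : PreservesOrbits F' F) (a : Ω) :
    ∃ t ∈ F', t ≠ 1 ∧ t a = a := by
  obtain ⟨τ, hτ, hτF⟩ := SetLike.exists_of_lt hFF
  obtain ⟨⟨e, he⟩, h⟩ := horb τ hτ a
  change e a = τ a at h
  refine ⟨e⁻¹ * τ, F'.mul_mem (F'.inv_mem (hFF.le he)) hτ, fun h1 => hτF ?_, ?_⟩
  · rw [← inv_mul_eq_one.1 h1]; exact he
  · rw [Equiv.Perm.mul_apply, Equiv.Perm.inv_eq_iff_eq, h]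

/-- For every vertex `w` other than the root there is an element of `K(F, F')` that is trivial on
the ball of radius `d(v₀, w)` and on the spheres around its vertices other than `w`, but moves a
neighbour of `w`. -/
theorem exists_mem_vertexStabPrescribed_moving (hT : T.IsTree) (hFF : F < F')
    (hF : IsSemiRegular F) (horb : PreservesOrbits F' F) {w : V} (hw : w ≠ v₀) :
    ∃ g ∈ vertexStabPrescribed hc F F' v₀,
      (∀ v, T.dist v₀ v ≤ T.dist v₀ w → g v = v) ∧
      (∀ v, T.dist v₀ v ≤ T.dist v₀ w → v ≠ w → ∀ a, g (nb hc v a) = nb hc v a) ∧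
      ∃ a, g (nb hc w a) ≠ nb hc w a := by
  classical
  obtain ⟨b, hb⟩ := exists_not_isChild hc hT v₀ hw
  obtain ⟨τ, hτ, hτ1, hτb⟩ := exists_mem_ne_one_apply_eq hFF horb b
  obtain ⟨g, hg, hg0, hgF⟩ := exists_mem_vertexStabPrescribed (hc := hc) (v₀ := v₀) hT hFF.le horb
    (fun v => if v = w then τ else 1)
    (fun v => by split_ifs; exacts [hτ, F'.one_mem])
    ((Set.finite_singleton w).subset fun v hv => by
      by_contra h
      rw [Set.mem_singleton_iff] at h
      simp [h, F.one_mem] at hv)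
  have hroot := apply_root_of_mem hg
  have key : ∀ v, T.dist v₀ v ≤ T.dist v₀ w → g v = v ∧
      localPerm hc g v = if v = w then τ else 1 := by
    refine rooted_induction hc hT v₀ (fun _ => ⟨hroot, hg0⟩) fun v a hch ih hle => ?_
    rw [hch] at hle
    have hvw : v ≠ w := by rintro rfl; omega
    obtain ⟨h1, h2⟩ := ih (by omega)
    rw [if_neg hvw] at h2
    refine ⟨by rw [apply_nb, h1, h2, Equiv.Perm.one_apply], ?_⟩
    have h3 : localPerm hc g (nb hc v a) a = a := by
      rw [localPerm_nb, h2, Equiv.Perm.one_apply]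
    have h4 := hgF (nb hc v a)
    split_ifs at h4 ⊢ with hvaw
    · have hab : a = b :=
        eq_of_not_isChild hc hT v₀ (not_isChild_nb hc v₀ hch) (hvaw ▸ hb)
      refine mul_inv_eq_one.1 (hF.eq_one h4 (a := b) ?_)
      rw [Equiv.Perm.mul_apply, Equiv.Perm.inv_eq_iff_eq.2 hτb.symm, ← hab, h3]
    · rw [inv_one, mul_one] at h4
      exact hF.eq_one h4 h3
  refine ⟨g, hg, fun v hv => (key v hv).1, fun v hv hvw a => ?_, ?_⟩
  · rw [apply_nb, (key v hv).1, (key v hv).2, if_neg hvw, Equiv.Perm.one_apply]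
  · obtain ⟨a, ha⟩ : ∃ a, τ a ≠ a := by
      by_contra! h
      exact hτ1 (Equiv.ext h)
    refine ⟨a, fun h => ha (nb_injective hc w ?_)⟩
    rw [← h, apply_nb, (key w le_rfl).1, (key w le_rfl).2, if_pos rfl]

/-- If `g` moves `v`, then it moves vertices at all larger distances from the root. -/
theorem exists_apply_ne_of_dist [Nontrivial Ω] (hc : IsLegalColoring c) (hT : T.IsTree)
    {g : T ≃g T} (hg : g v₀ = v₀) {v : V}
    (hv : g v ≠ v) (r : ℕ) : ∃ w, T.dist v₀ w = T.dist v₀ v + r ∧ g w ≠ w := by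
  induction r with
  | zero => exact ⟨v, rfl, hv⟩
  | succ r ih =>
    obtain ⟨w, hw, hgw⟩ := ih
    obtain ⟨a, ha⟩ : ∃ a, IsChild hc v₀ w a := by
      by_contra! h
      obtain ⟨a, b, hab⟩ := exists_pair_ne Ω
      exact hab (eq_of_not_isChild hc hT v₀ (h a) (h b))
    refine ⟨nb hc w a, by rw [ha, hw, Nat.add_assoc], fun h => hgw ?_⟩
    have h1 := not_isChild_nb hc v₀ ((isChild_apply_iff hc hT hg w a).2 ha)
    rw [← apply_nb, h] at h1
    have h2 := eq_of_not_isChild hc hT v₀ h1 (not_isChild_nb hc v₀ ha)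
    rw [← nb_nb hc (g w) (localPerm hc g w a), ← apply_nb, h, h2, nb_nb]

/-- Conjugating `g` by elements that are concentrated at vertices moved by `g` and farther and
farther away from the root gives infinitely many conjugates. -/
theorem isICC_vertexStabPrescribed [Nontrivial Ω] (hT : T.IsTree) (hFF : F < F')
    (hF : IsSemiRegular F) (horb : PreservesOrbits F' F) :
    IsICC (vertexStabPrescribed hc F F' v₀) := by
  rintro ⟨g, hg⟩ hg1
  have hroot := apply_root_of_mem hg
  obtain ⟨v, hv⟩ : ∃ v, g v ≠ v := by
    by_contra! h
    exact hg1 (Subtype.ext (RelIso.ext h))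
  choose w hw hgw using fun r => exists_apply_ne_of_dist hc hT hroot hv r
  have hw0 : ∀ r, w r ≠ v₀ := fun r h => hgw r (by rw [h, hroot])
  choose γ hγ hball hsph hmove using fun r =>
    exists_mem_vertexStabPrescribed_moving (hc := hc) hT hFF hF horb (hw0 r)
  refine Set.infinite_of_injective_forall_mem
    (f := fun r : ℕ => (⟨γ r, hγ r⟩ * ⟨g, hg⟩ * ⟨γ r, hγ r⟩⁻¹ : vertexStabPrescribed hc F F' v₀))
    ?_ fun r => isConj_iff.2 ⟨_, rfl⟩
  have key : ∀ r r', r < r' → γ r * g * (γ r)⁻¹ ≠ γ r' * g * (γ r')⁻¹ := by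
    intro r r' hrr h
    obtain ⟨a, ha⟩ := hmove r
    -- the conjugates are compared at a neighbour of `w r` that is moved by `γ r`
    set x := γ r (nb hc (w r) a)
    have hx : x = nb hc (w r) (localPerm hc (γ r) (w r) a) := by
      simp only [x]
      rw [apply_nb, hball r _ le_rfl]
    have hdist : T.dist v₀ x ≤ T.dist v₀ (w r') := by
      have h1 := hT.dist_eq_dist_add_one_of_adj v₀ (adj_nb hc (w r) (localPerm hc (γ r) (w r) a))
      rw [← hx] at h1
      rw [hw] at h1 ⊢
      omega
    have h1 : (γ r * g * (γ r)⁻¹) x = g (nb hc (w r) a) := by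
      simp only [RelIso.mul_apply, x, RelIso.inv_apply_self]
      rw [apply_nb hc g]
      refine hsph r _ ?_ (hgw r) _
      rw [dist_apply_of_fixed hT hroot]
    have h2 : (γ r' * g * (γ r')⁻¹) x = g x := by
      have h3 : (γ r')⁻¹ x = x := by
        conv_lhs => rw [← hball r' x hdist]
        exact RelIso.inv_apply_self _ _
      rw [RelIso.mul_apply, RelIso.mul_apply, h3]
      refine hball r' _ ?_
      rwa [dist_apply_of_fixed hT hroot]
    rw [h, h2] at h1
    exact ha (g.injective h1)
  intro r r' h
  have h' : γ r * g * (γ r)⁻¹ = γ r' * g * (γ r')⁻¹ := congrArg Subtype.val h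
  rcases lt_trichotomy r r' with hlt | heq | hlt
  · exact (key r r' hlt h').elim
  · exact heq
  · exact (key r' r hlt h'.symm).elim

/-- The subgroup of `K(F, F')` of the elements whose local permutations at distance at least `m`
from the root are in `F`. -/
noncomputable def vertexStabLevel (hc : IsLegalColoring c) (F F' : Subgroup (Equiv.Perm Ω)) (v₀ : V)
    (hT : T.IsTree) (m : ℕ) : Subgroup (vertexStabPrescribed hc F F' v₀) where
  carrier := {g | ∀ v, m ≤ T.dist v₀ v → localPerm hc g.1 v ∈ F}
  one_mem' v _ := by
    rw [Subgroup.coe_one, localPerm_one]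
    exact F.one_mem
  mul_mem' {g h} hg hh v hv := by
    rw [Subgroup.coe_mul, localPerm_mul]
    refine F.mul_mem (hg _ ?_) (hh _ hv)
    rwa [dist_apply_of_fixed hT (apply_root_of_mem h.2)]
  inv_mem' {g} hg v hv := by
    rw [Subgroup.coe_inv, localPerm_inv]
    refine F.inv_mem (hg _ ?_)
    rwa [dist_apply_of_fixed hT (apply_root_of_mem (Subgroup.inv_mem _ g.2))]

theorem vertexStabLevel_mono (hT : T.IsTree) :
    Monotone (vertexStabLevel hc F F' v₀ hT) :=
  fun _ _ h _ hg v hv => hg v (h.trans hv)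

theorem finite_vertexStabLevel [Finite Ω] (hT : T.IsTree) (hF : IsSemiRegular F) (m : ℕ) :
    Finite (vertexStabLevel hc F F' v₀ hT m) := by
  have := (finite_dist_le hc hT v₀ m).to_subtype
  refine Finite.of_injective
    (fun (g : vertexStabLevel hc F F' v₀ hT m) (v : {v | T.dist v₀ v ≤ m}) =>
      localPerm hc g.1.1 v.1) fun g h hgh => Subtype.ext (Subtype.ext ?_)
  exact eq_of_localPerm_eq hT hF (apply_root_of_mem g.1.2) (apply_root_of_mem h.1.2) m
    (fun v hv => congrFun hgh ⟨v, hv⟩) (fun v hv => g.2 v hv.le) (fun v hv => h.2 v hv.le)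

theorem exists_mem_vertexStabLevel (hT : T.IsTree) (g : vertexStabPrescribed hc F F' v₀) :
    ∃ m, g ∈ vertexStabLevel hc F F' v₀ hT m := by
  obtain ⟨m, hm⟩ := (g.2.1.2.image fun v => T.dist v₀ v).bddAbove
  refine ⟨m + 1, fun v hv => ?_⟩
  by_contra h
  have := hm ⟨v, h, rfl⟩
  dsimp only at this
  omega

end Prescribed

/-! ### The lattice embedding -/

section Embedding

variable {V Ω : Type*} {T : SimpleGraph V} {c : T.EdgeLabeling Ω} {hc : IsLegalColoring c}
  {v₀ : V} {F F' : Subgroup (Equiv.Perm Ω)} {n : ℕ} [NeZero n]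

/-- The action of `F'` on the cosets of a subgroup `F` of index `n`, as permutations of `Fin n`
with `F` corresponding to `0`. -/
theorem exists_coset_hom (hn : F.relIndex F' = n) :
    ∃ ρ : F' →* Equiv.Perm (Fin n), (∀ t : F', ρ t 0 = 0 ↔ (t : Equiv.Perm Ω) ∈ F) ∧
      ∀ i, ∃ t : F', ρ t 0 = i := by
  set Q := F' ⧸ F.subgroupOf F'
  have hQ : Nat.card Q = n := hn
  have : Finite Q := Nat.finite_of_card_ne_zero (by rw [hQ]; exact NeZero.ne n)
  let e₁ : Q ≃ Fin n := Finite.equivFinOfCardEq hQ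
  let e : Q ≃ Fin n := e₁.trans (Equiv.swap (e₁ ((1 : F') : Q)) 0)
  have he : e ((1 : F') : Q) = 0 := by simp [e]
  have he' : e.symm 0 = ((1 : F') : Q) := by rw [← he, Equiv.symm_apply_apply]
  let ρ : F' →* Equiv.Perm (Fin n) := e.permCongrHom.toMonoidHom.comp (MulAction.toPermHom F' Q)
  have hρ : ∀ t : F', ρ t 0 = e (t : Q) := by
    intro t
    change e (t • e.symm 0) = _
    rw [he', ← QuotientGroup.mk_mul_of_mem t (F.subgroupOf F').one_mem]
    rfl
  refine ⟨ρ, fun t => ?_, fun i => ?_⟩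
  · rw [hρ, ← he, e.injective.eq_iff, eq_comm, QuotientGroup.eq, inv_one, one_mul,
      Subgroup.mem_subgroupOf]
  · obtain ⟨t, ht⟩ := QuotientGroup.mk_surjective (e.symm i)
    exact ⟨t, by rw [hρ, ht, Equiv.apply_symm_apply]⟩

/-- The homomorphism `K(F, F') → H_{n,d}` that maps `g` to `(f, g)`, where `f v` is the action of
the local permutation of `g` at `g⁻¹ v` on the cosets of `F` in `F'`. -/
noncomputable def wreathEmbedding (hc : IsLegalColoring c) (v₀ : V)
    (ρ : F' →* Equiv.Perm (Fin n)) (hρ : ∀ t : F', ρ t 0 = 0 ↔ (t : Equiv.Perm Ω) ∈ F) :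
    vertexStabPrescribed hc F F' v₀ →* WreathStab T v₀ n where
  toFun g := ⟨⟨fun v => ρ ⟨localPerm hc g.1 (g.1⁻¹ v), g.2.1.1 _⟩,
    (g.2.1.2.preimage (g.1⁻¹).injective.injOn).subset fun _ hv hvF => hv ((hρ _).2 hvF)⟩,
    ⟨g.1, g.2.2⟩⟩
  map_one' := by
    ext : 1
    · refine Subtype.ext (funext fun v => ?_)
      simp only [Subgroup.coe_one, localPerm_one]
      exact map_one ρ
    · rfl
  map_mul' g h := by
    ext : 1
    · refine Subtype.ext (funext fun v => ?_)
      simp only [SemidirectProduct.mul_left, Subgroup.coe_mul, Pi.mul_apply,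
        semiRestrictedAction_apply]
      rw [← map_mul]
      congr 1
      refine Subtype.ext ?_
      simp only [Subgroup.coe_mul, localPerm_mul, mul_inv_rev, RelIso.mul_apply,
        RelIso.apply_inv_self]
      rfl
    · rfl

variable {ρ : F' →* Equiv.Perm (Fin n)} {hρ : ∀ t : F', ρ t 0 = 0 ↔ (t : Equiv.Perm Ω) ∈ F}

theorem wreathEmbedding_injective : Function.Injective (wreathEmbedding hc v₀ ρ hρ) := by
  intro g h hgh
  have h1 : (wreathEmbedding hc v₀ ρ hρ g).right = (wreathEmbedding hc v₀ ρ hρ h).right := by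
    rw [hgh]
  exact Subtype.ext (congrArg (fun k : MulAction.stabilizer (T ≃g T) v₀ => k.1) h1)

/-- An element whose image is in the base subgroup has its local permutations in the semi-regular
group `F`, so that it is trivial if it fixes the neighbours of the root. -/
theorem discreteTopology_range_wreathEmbedding [Finite Ω] (hT : T.IsTree) (hF : IsSemiRegular F)
    [IsTopologicalGroup (WreathStab T v₀ n)] :
    DiscreteTopology (wreathEmbedding hc v₀ ρ hρ).range := by
  let U : Set (WreathStab T v₀ n) := wreathBase V _ _ ∩
    ⋂ a : Ω, {g | g.right • nb hc v₀ a = nb hc v₀ a}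
  have hU : IsOpen U := isOpen_wreathBase.inter (isOpen_iInter_of_finite fun a =>
    (isOpen_setOf_stabilizer_smul_eq v₀ _ _).preimage continuous_wreath_right)
  refine discreteTopology_of_isOpen_singleton_one ?_
  have hU1 : ({1} : Set (wreathEmbedding hc v₀ ρ hρ).range) = Subtype.val ⁻¹' U := by
    refine Set.Subset.antisymm ?_ ?_
    · rintro _ rfl
      refine ⟨fun v => Subgroup.one_mem _, Set.mem_iInter.2 fun a => rfl⟩
    · rintro ⟨_, g, rfl⟩ ⟨hg1, hg2⟩
      have hroot := apply_root_of_mem g.2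
      have hgF : ∀ v, localPerm hc g.1 v ∈ F := by
        intro v
        have h1 : localPerm hc g.1 (g.1⁻¹ (g.1 v)) ∈ F := (hρ _).1 (hg1 (g.1 v))
        rwa [RelIso.inv_apply_self] at h1
      have hg0 : localPerm hc g.1 v₀ = 1 := localPerm_eq_of_apply_nb hc fun a => by
        rw [hroot]
        exact Set.mem_iInter.1 hg2 a
      have hg : g = 1 := by
        refine Subtype.ext (eq_of_localPerm_eq (h := 1) hT hF hroot rfl 0 (fun v hv => ?_)
          (fun v _ => hgF v) fun v _ => by rw [localPerm_one]; exact F.one_mem)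
        rw [← (hT.connected.dist_eq_zero_iff).1 (Nat.le_zero.1 hv), hg0, localPerm_one]
      subst hg
      exact Subtype.ext (map_one _)
  rw [hU1]
  exact hU.preimage continuous_subtype_val

/-- Every element of `H_{n,d}` is in the compact set `𝔖_{n-1}^V ⋊ K_d` after multiplication by an
element of the image: the required element of `K(F, F')` is one with prescribed cosets of local
permutations. -/
theorem compactSpace_quotient_wreathEmbedding (hT : T.IsTree) (hFF : F ≤ F')
    (horb : PreservesOrbits F' F) (hsurj : ∀ i, ∃ t : F', ρ t 0 = i)
    [CompactSpace (MulAction.stabilizer (T ≃g T) v₀)] :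
    CompactSpace (WreathStab T v₀ n ⧸ (wreathEmbedding hc v₀ ρ hρ).range) := by
  refine ⟨?_⟩
  have hC : IsCompact (wreathBase V (MulAction.stabilizer (Equiv.Perm (Fin n)) (0 : Fin n))
    (MulAction.stabilizer (T ≃g T) v₀)) := isCompact_wreathBase
  convert hC.image (QuotientGroup.continuous_mk (N := (wreathEmbedding hc v₀ ρ hρ).range)) using 1
  refine (Set.eq_univ_of_forall fun q => ?_).symm
  obtain ⟨x, rfl⟩ := QuotientGroup.mk_surjective q
  choose t ht using fun v => hsurj ((x.left.1 (x.right • v))⁻¹ 0)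
  have htF : ∀ v, x.left.1 (x.right • v) 0 = 0 → (t v : Equiv.Perm Ω) ∈ F := by
    intro v hv
    rw [← hρ, ht, Equiv.Perm.inv_eq_iff_eq, hv]
  obtain ⟨h, hh, -, hhF⟩ := exists_mem_vertexStabPrescribed (hc := hc) (v₀ := v₀) hT hFF horb
    (fun v => ((t v)⁻¹ : F').1) (fun v => ((t v)⁻¹ : F').2)
    ((Set.Finite.preimage (MulAction.injective x.right).injOn x.left.2).subset
      fun v hv hvF => hv (F.inv_mem (htF v hvF)))
  set γ : vertexStabPrescribed hc F F' v₀ := ⟨h, hh⟩⁻¹ with hγ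
  refine ⟨x * wreathEmbedding hc v₀ ρ hρ γ, fun v => ?_,
    QuotientGroup.mk_mul_of_mem x ⟨γ, rfl⟩⟩
  set y := x.right⁻¹ • v with hy
  have hv : v = x.right • y := by rw [hy, smul_inv_smul]
  have e1 : (wreathEmbedding hc v₀ ρ hρ γ).left.1 y 0 = (x.left.1 v)⁻¹ 0 := by
    rw [hv, ← ht y]
    have e2 : (⟨localPerm hc γ.1 (γ.1⁻¹ y), γ.2.1.1 _⟩ : F') =
        t y * ⟨(localPerm hc h y * t y)⁻¹, F'.inv_mem (F'.mul_mem (hh.1.1 y) (t y).2)⟩ := by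
      refine Subtype.ext ?_
      have e3 : γ.1⁻¹ y = h y := by
        rw [hγ]
        change (h⁻¹)⁻¹ y = h y
        rw [inv_inv]
      change localPerm hc γ.1 (γ.1⁻¹ y) = (t y : Equiv.Perm Ω) * (localPerm hc h y * t y)⁻¹
      rw [e3]
      change localPerm hc h⁻¹ (h y) = _
      rw [localPerm_inv, RelIso.inv_apply_self, mul_inv_rev, mul_inv_cancel_left]
    change ρ ⟨localPerm hc γ.1 (γ.1⁻¹ y), γ.2.1.1 _⟩ 0 = _
    rw [e2, map_mul, Equiv.Perm.mul_apply]
    congr 1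
    refine (hρ _).2 (F.inv_mem ?_)
    simpa using hhF y
  change (x.left.1 v * (wreathEmbedding hc v₀ ρ hρ γ).left.1 y) 0 = 0
  rw [Equiv.Perm.mul_apply, e1]
  exact (x.left.1 v).apply_symm_apply 0

end Embedding

/-! ### The tree of reduced words -/

section ReducedWords

variable (Ω : Type*)

/-- The words over `Ω` without two equal consecutive letters. -/
abbrev ReducedWord : Type _ :=
  {l : List Ω // l.IsChain (· ≠ ·)}

/-- The tree of reduced words, in which a word is joined to the words obtained by adding a letter on
the left. -/
def reducedWordTree : SimpleGraph (ReducedWord Ω) where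
  Adj v w := (∃ a, w.1 = a :: v.1) ∨ ∃ a, v.1 = a :: w.1
  symm := ⟨fun _ _ h => h.symm⟩
  loopless := ⟨fun v h => by
    rcases h with ⟨a, h⟩ | ⟨a, h⟩ <;> simpa using congrArg List.length h⟩

variable {Ω}

theorem reducedWordTree_reachable_nil (l : List Ω) (hl : l.IsChain (· ≠ ·)) :
    (reducedWordTree Ω).Reachable ⟨[], List.IsChain.nil⟩ ⟨l, hl⟩ := by
  induction l with
  | nil => exact SimpleGraph.Reachable.refl _
  | cons a l ih =>
    have hl' : l.IsChain (· ≠ ·) := hl.tail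
    exact (ih hl').trans (SimpleGraph.Adj.reachable (Or.inl ⟨a, rfl⟩))

/-- The edge from `v` to `a v` separates the words that end in `a v` from the other words. -/
theorem reducedWordTree_not_reachable {v w : ReducedWord Ω} {a : Ω} (h : w.1 = a :: v.1) :
    ¬ ((reducedWordTree Ω).deleteEdges {s(v, w)}).Reachable w v := by
  rintro ⟨p⟩
  have key : ∀ x y : ReducedWord Ω, ((reducedWordTree Ω).deleteEdges {s(v, w)}).Walk x y →
      w.1 <:+ x.1 → w.1 <:+ y.1 := by
    intro x y p
    induction p with
    | nil => exact id
    | @cons x y _ hxy _ ih =>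
      intro hx
      refine ih ?_
      rw [SimpleGraph.deleteEdges_adj] at hxy
      obtain ⟨⟨b, hb⟩ | ⟨b, hb⟩, hne⟩ := hxy
      · rw [hb]
        exact hx.trans (List.suffix_cons b _)
      · rw [hb] at hx
        rcases List.suffix_cons_iff.1 hx with hwx | hwy
        · refine absurd ?_ hne
          have h1 : w = x := Subtype.ext (hwx.trans hb.symm)
          have h2 : v = y := Subtype.ext (by
            rw [h] at hwx
            exact (List.cons.inj hwx).2)
          rw [h1, h2, Sym2.eq_swap]
          exact Set.mem_singleton _
        · exact hwy
  have h1 := (key w v p (List.suffix_refl _)).length_le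
  rw [h, List.length_cons] at h1
  omega

theorem isTree_reducedWordTree : (reducedWordTree Ω).IsTree := by
  refine ⟨?_, SimpleGraph.isAcyclic_iff_forall_adj_isBridge.2 fun v w hvw => ?_⟩
  · have : Nonempty (ReducedWord Ω) := ⟨⟨[], List.IsChain.nil⟩⟩
    refine ⟨fun v w => ?_⟩
    exact (reducedWordTree_reachable_nil v.1 v.2).symm.trans
      (reducedWordTree_reachable_nil w.1 w.2)
  · rw [SimpleGraph.isBridge_iff]
    rcases hvw with ⟨a, h⟩ | ⟨a, h⟩
    · exact fun hr => reducedWordTree_not_reachable h hr.symm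
    · rw [Sym2.eq_swap]
      exact reducedWordTree_not_reachable h

variable [Inhabited Ω]

/-- The edges of the tree of reduced words are coloured by the letter that is added. -/
def reducedWordColoring : (reducedWordTree Ω).EdgeLabeling Ω :=
  SimpleGraph.EdgeLabeling.mk
    (fun v w _ => if v.1.length < w.1.length then w.1.headD default else v.1.headD default)
    (fun v w h => by
      rcases h with ⟨a, h⟩ | ⟨a, h⟩ <;> simp [h])

theorem isLegalColoring_reducedWordColoring :
    IsLegalColoring (reducedWordColoring (Ω := Ω)) := by
  classical
  intro v
  constructor
  · rintro ⟨w, hw⟩ ⟨w', hw'⟩ h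
    change (if v.1.length < w.1.length then w.1.headD default else v.1.headD default) =
      if v.1.length < w'.1.length then w'.1.headD default else v.1.headD default at h
    refine Subtype.ext (Subtype.ext ?_)
    rcases hw with ⟨a, ha⟩ | ⟨a, ha⟩ <;> rcases hw' with ⟨b, hb⟩ | ⟨b, hb⟩
    · simp only [ha, hb, List.length_cons, Nat.lt_add_one, if_true, List.headD_cons] at h
      simp only [ha, hb, h]
    · have h1 := w.2
      simp only [ha, hb, List.length_cons, Nat.lt_add_one, if_true, List.headD_cons] at h
      rw [if_neg (by omega)] at h
      rw [ha, hb, h, List.isChain_cons_cons] at h1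
      exact absurd rfl h1.1
    · have h1 := w'.2
      simp only [ha, hb, List.length_cons, Nat.lt_add_one, if_true, List.headD_cons] at h
      rw [if_neg (by omega)] at h
      rw [hb, ha, h, List.isChain_cons_cons] at h1
      exact absurd rfl h1.1
    · rw [ha] at hb
      exact (List.cons.inj hb).2
  · intro a
    by_cases hv : ∃ t, v.1 = a :: t
    · obtain ⟨t, ht⟩ := hv
      have ht' : t.IsChain (· ≠ ·) := by
        have := v.2
        rw [ht] at this
        exact this.tail
      refine ⟨⟨⟨t, ht'⟩, Or.inr ⟨a, ht⟩⟩, ?_⟩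
      change (if v.1.length < t.length then t.headD default else v.1.headD default) = a
      simp [ht]
    · have hv' : (a :: v.1).IsChain (· ≠ ·) := by
        obtain ⟨l, hl⟩ := v
        cases l with
        | nil => exact List.IsChain.singleton a
        | cons b t =>
          refine List.isChain_cons_cons.2 ⟨?_, hl⟩
          rintro rfl
          exact hv ⟨t, rfl⟩
      refine ⟨⟨⟨a :: v.1, hv'⟩, Or.inl ⟨a, rfl⟩⟩, ?_⟩
      change (if v.1.length < (a :: v.1).length then (a :: v.1).headD default else _) = a
      simp

end ReducedWords

/-! ### Strong amenability is not inherited by discrete cocompact subgroups -/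

theorem nontrivial_vertexStabPrescribed {V Ω : Type*} [Nonempty Ω] {T : SimpleGraph V}
    (hT : T.IsTree) {c : T.EdgeLabeling Ω} (hc : IsLegalColoring c) (v₀ : V)
    {F F' : Subgroup (Equiv.Perm Ω)} (hFF : F < F') (hF : IsSemiRegular F)
    (horb : PreservesOrbits F' F) : Nontrivial (vertexStabPrescribed hc F F' v₀) := by
  obtain ⟨g, hg, -, -, a, ha⟩ := exists_mem_vertexStabPrescribed_moving (hc := hc) hT hFF hF horb
    (adj_nb hc v₀ (Classical.arbitrary Ω)).ne'
  refine ⟨⟨g, hg⟩, 1, fun h => ha ?_⟩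
  have h1 : g = 1 := congrArg Subtype.val h
  rw [h1]
  rfl

/-- The properties of `K(F, F')`, `H_{n,d}` and the embedding, for all trees. The group `K(F, F')`
is exhausted by the finite subgroups of the elements with local permutations in `F` outside of a
ball, so that its discrete copy in `H_{n,d}` is not strongly amenable. -/
theorem wreathStab_lattice {V : Type v} {Ω : Type w} [Fintype Ω] (hΩ : 3 ≤ Fintype.card Ω)
    {T : SimpleGraph V} (hT : T.IsTree) {c : T.EdgeLabeling Ω} (hc : IsLegalColoring c) (v₀ : V)
    (F F' : Subgroup (Equiv.Perm Ω)) (hFF : F < F') (hF : IsSemiRegular F)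
    (horb : PreservesOrbits F' F) (n : ℕ) [NeZero n] (hn : F.relIndex F' = n) :
    Countable (vertexStabPrescribed hc F F' v₀) ∧
      IsICC (vertexStabPrescribed hc F F' v₀) ∧
      IsTopologicalGroup (WreathStab T v₀ n) ∧
      LocallyCompactSpace (WreathStab T v₀ n) ∧
      T2Space (WreathStab T v₀ n) ∧
      StronglyAmenable.{u} (WreathStab T v₀ n) ∧
      ∃ φ : vertexStabPrescribed hc F F' v₀ →* WreathStab T v₀ n,
        Function.Injective φ ∧
        DiscreteTopology φ.range ∧
        CompactSpace (WreathStab T v₀ n ⧸ φ.range) ∧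
        ¬ StronglyAmenable.{u} φ.range := by
  have : Nontrivial Ω := Fintype.one_lt_card_iff_nontrivial.1 (by omega)
  have hcomp := compactSpace_stabilizer hT v₀ (finite_dist_le hc hT v₀)
  have hopen := isOpen_setOf_stabilizer_smul_eq (T := T) v₀
  have hICC : IsICC (vertexStabPrescribed hc F F' v₀) := isICC_vertexStabPrescribed hT hFF hF horb
  have hgroup : IsTopologicalGroup (WreathStab T v₀ n) := isTopologicalGroup_wreath hopen
  have hfin := finite_vertexStabLevel (hc := hc) (F' := F') (v₀ := v₀) hT hF
  obtain ⟨ρ, hρ, hsurj⟩ := exists_coset_hom hn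
  set φ := wreathEmbedding hc v₀ ρ hρ
  have hφ : Function.Injective φ := wreathEmbedding_injective
  have hdisc : DiscreteTopology φ.range := discreteTopology_range_wreathEmbedding hT hF
  refine ⟨countable_of_forall_exists_mem _ hfin (exists_mem_vertexStabLevel hT), hICC, hgroup,
    locallyCompactSpace_wreath hopen, t2Space_wreath, stronglyAmenable_wreath hopen, φ, hφ, hdisc,
    compactSpace_quotient_wreathEmbedding hT hFF.le horb hsurj, ?_⟩
  let e : vertexStabPrescribed hc F F' v₀ ≃* φ.range := MonoidHom.ofInjective hφ
  have := nontrivial_vertexStabPrescribed hT hc v₀ hFF hF horb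
  have : Nontrivial φ.range := e.symm.toEquiv.nontrivial
  exact (hICC.of_mulEquiv e).not_stronglyAmenable
    (L := fun m => (vertexStabLevel hc F F' v₀ hT m).map e.toMonoidHom)
    (fun i j hij => Subgroup.map_mono (vertexStabLevel_mono hT hij))
    (fun m => have := hfin m
      Finite.of_surjective _
        (e.toMonoidHom.subgroupMap_surjective (vertexStabLevel hc F F' v₀ hT m)))
    fun g => (exists_mem_vertexStabLevel hT (e.symm g)).imp fun m hm =>
      ⟨_, hm, e.apply_symm_apply g⟩

theorem isSemiRegular_alternatingGroup_three : IsSemiRegular (alternatingGroup (Fin 3)) := by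
  have h : ∀ σ : Equiv.Perm (Fin 3), σ.sign = 1 → ∀ a, σ a = a → σ = 1 := by decide
  intro a
  rw [Subgroup.eq_bot_iff_forall]
  exact fun σ hσ => Subtype.ext (h σ.1 (Equiv.Perm.mem_alternatingGroup.1 σ.2) a hσ)

theorem preservesOrbits_alternatingGroup_three :
    PreservesOrbits ⊤ (alternatingGroup (Fin 3)) := by
  have h : ∀ a b : Fin 3, ∃ σ : Equiv.Perm (Fin 3), σ.sign = 1 ∧ σ a = b := by decide
  intro σ _ a
  obtain ⟨τ, hτ, hτa⟩ := h a (σ a)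
  exact ⟨⟨τ, Equiv.Perm.mem_alternatingGroup.2 hτ⟩, hτa⟩

theorem alternatingGroup_three_lt_top : alternatingGroup (Fin 3) < ⊤ := by
  refine lt_top_iff_ne_top.2 fun h => ?_
  have h1 : Equiv.swap (0 : Fin 3) 1 ∈ alternatingGroup (Fin 3) := h ▸ Subgroup.mem_top _
  rw [Equiv.Perm.mem_alternatingGroup, Equiv.Perm.sign_swap (by decide)] at h1
  exact absurd h1 (by decide)

theorem proposition3p4 :
    -- the groups `K(F, F')` and `H_{n,d}`
    (∀ {V : Type v} {Ω : Type w} [Fintype Ω] (_ : 3 ≤ Fintype.card Ω)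
      {T : SimpleGraph V} (_ : T.IsTree) {c : T.EdgeLabeling Ω} (hc : IsLegalColoring c) (v₀ : V)
      (F F' : Subgroup (Equiv.Perm Ω)) (_ : F < F') (_ : IsSemiRegular F)
      (_ : PreservesOrbits F' F) (n : ℕ) [NeZero n] (_ : F.relIndex F' = n),
      Countable (vertexStabPrescribed hc F F' v₀) ∧
      IsICC (vertexStabPrescribed hc F F' v₀) ∧
      IsTopologicalGroup (WreathStab T v₀ n) ∧
      LocallyCompactSpace (WreathStab T v₀ n) ∧
      T2Space (WreathStab T v₀ n) ∧
      StronglyAmenable.{u} (WreathStab T v₀ n) ∧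
      ∃ φ : vertexStabPrescribed hc F F' v₀ →* WreathStab T v₀ n,
        Function.Injective φ ∧
        DiscreteTopology φ.range ∧
        CompactSpace (WreathStab T v₀ n ⧸ φ.range) ∧
        ¬ StronglyAmenable.{u} φ.range) ∧
    -- strong amenability does not pass to discrete cocompact subgroups
    ∃ (G : Type) (_ : Group G) (_ : TopologicalSpace G) (_ : IsTopologicalGroup G)
      (_ : LocallyCompactSpace G) (_ : T2Space G) (Γ : Subgroup G),
      StronglyAmenable.{u} G ∧
      DiscreteTopology Γ ∧
      CompactSpace (G ⧸ Γ) ∧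
      ¬ StronglyAmenable.{u} Γ := by
  refine ⟨fun hΩ _ hT _ hc v₀ F F' hFF hF horb n _ hn =>
    wreathStab_lattice hΩ hT hc v₀ F F' hFF hF horb n hn, ?_⟩
  have hne : NeZero ((alternatingGroup (Fin 3)).relIndex ⊤) :=
    ⟨Subgroup.FiniteIndex.index_ne_zero⟩
  obtain ⟨-, -, h1, h2, h3, h4, φ, -, h5, h6, h7⟩ := wreathStab_lattice.{u} (by simp)
    (isTree_reducedWordTree (Ω := Fin 3)) isLegalColoring_reducedWordColoring
    ⟨[], List.IsChain.nil⟩ (alternatingGroup (Fin 3)) ⊤ alternatingGroup_three_lt_top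
    isSemiRegular_alternatingGroup_three preservesOrbits_alternatingGroup_three _ rfl
  exact ⟨_, _, _, h1, h2, h3, φ.range, h4, h5, h6, h7⟩
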